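/- Let $N\ge 2$ and $0\le a<b\le 1$. Zhang's sandpile model $(N,[a,b])$ is the following Markov chain on the set $[0,1)^N$ of stable configurations. In each time step, given the current configuration $\eta$, choose a site $X$ uniformly in $\{1,\dots,N\}$ and an amount $U$ uniformly distributed on $[a,b]$, independently of each other and of the past, and add $U$ to $\eta_X$. Then stabilize the result: as long as some site $x$ is unstable, i.e. has height at least $1$, topple an unstable site $x$, which means that the height $h$ of $x$ is replaced by $0$ and each neighbour $y\in\{1,\dots,N\}$, $|y-x|=1$, receives $h/2$ (so that $h/2$ is lost if $x$ is a boundary site). This ends after finitely many topplings, and the resulting configuration in $[0,1)^N$, which does not depend on the order of the topplings, is the next state. Theorem 3.1. The model $(N,[a,b])$ has a unique stationary distribution, denoted by $\mu^{a,b,N}$, i.e. there is exactly one probability measure on $[0,1)^N$ that is invariant under this chain. Moreover, for every initial distribution $\nu$ on $[0,1)^N$, the distribution $\nu_t$ of the chain at time $t$ converges to $\mu^{a,b,N}$ in total variation as $t\to\infty$: $$\sup_{A}\bigl|\nu_t(A)-\mu^{a,b,N}(A)\bigr|\longrightarrow 0,$$ where the supremum is over all Borel sets $A\subseteq[0,1)^N$.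 -/

import Mathlib

open MeasureTheory ProbabilityTheory

namespace Zhang

/-- Two sites of the line `0, …, N - 1` are neighbours: their distance is one. -/
def Adj {N : ℕ} (x y : Fin N) : Prop := (x : ℕ) + 1 = y ∨ (y : ℕ) + 1 = x

/-- The set `[0, 1)^N` of stable configurations. -/
def stableSet (N : ℕ) : Set (Fin N → ℝ) := {η | ∀ x, 0 ≤ η x ∧ η x < 1}

/-- The state space of the model. -/
abbrev Stable (N : ℕ) : Type := stableSet N

open Classical in
/-- The Zhang toppling operator at site `x`: if `x` is unstable, it becomes empty and each
neighbour receives half of its height (at a boundary site one half is lost);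
otherwise nothing happens. -/
noncomputable def topple {N : ℕ} (x : Fin N) (η : Fin N → ℝ) : Fin N → ℝ :=
  if 1 ≤ η x then
    fun y => if y = x then 0 else if Adj x y then η y + η x / 2 else η y
  else η

/-- `ξ` arises from `η` by toppling one unstable site. -/
def TopplesTo {N : ℕ} (η ξ : Fin N → ℝ) : Prop := ∃ x, 1 ≤ η x ∧ ξ = topple x η

/-- Go once through all the sites, from left to right, and topple those that are unstable. -/
noncomputable def sweep {N : ℕ} (η : Fin N → ℝ) : Fin N → ℝ :=
  (List.finRange N).foldl (fun ζ x => topple x ζ) η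

/-- The number of sweeps after which the configuration is stable for the first time. -/
noncomputable def sweepCount {N : ℕ} (η : Fin N → ℝ) : ℕ :=
  sInf {n | (sweep^[n] η) ∈ stableSet N}

/-- Stabilization through topplings of unstable sites, sweep by sweep until the configuration is
stable. That this ends, for every configuration in `[0, ∞)^N`, is `stabilize_mem`; that it is a
sequence of topplings of unstable sites is `reaches_stabilize`; that, after an addition to a stable
configuration, every other order of topplings has the same result is `eq_stabilize`. -/
noncomputable def stabilize {N : ℕ} (η : Fin N → ℝ) : Fin N → ℝ := sweep^[sweepCount η] η

section Termination

variable {N : ℕ}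

theorem topple_nonneg (x : Fin N) {η : Fin N → ℝ} (h : ∀ y, 0 ≤ η y) (y : Fin N) :
    0 ≤ topple x η y := by
  have h1 := h x
  have h2 := h y
  unfold topple
  split_ifs
  · dsimp only
    split_ifs <;> linarith
  · exact h2

/-- A weighted total mass; each toppling of `x` lowers it by exactly the height at `x`. -/
noncomputable def potential (η : Fin N → ℝ) : ℝ :=
  ∑ y : Fin N, ((y : ℝ) + 1) * ((N : ℝ) - y) * η y

theorem potential_nonneg {η : Fin N → ℝ} (h : ∀ y, 0 ≤ η y) : 0 ≤ potential η := by
  refine Finset.sum_nonneg fun y _ => ?_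
  have h1 : (y : ℝ) < N := by exact_mod_cast y.2
  have h2 : (0 : ℝ) ≤ N - y := by linarith
  have := h y
  positivity

theorem sum_right (x : Fin N) (f : ℝ → ℝ) (hf : f N = 0) :
    ∑ y : Fin N, (if (x : ℕ) + 1 = y then f (y : ℝ) else 0) = f ((x : ℝ) + 1) := by
  by_cases h : (x : ℕ) + 1 < N
  · rw [Finset.sum_eq_single (⟨x + 1, h⟩ : Fin N)]
    · simp
    · intro b _ hb
      rw [if_neg]
      intro h'
      exact hb (Fin.ext h'.symm)
    · simp
  · have h1 : (x : ℕ) + 1 = N := by have := x.2; omega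
    have h2 : (x : ℝ) + 1 = N := by exact_mod_cast h1
    rw [h2, hf]
    refine Finset.sum_eq_zero fun y _ => ?_
    rw [if_neg]
    have := y.2
    omega

theorem sum_left (x : Fin N) (f : ℝ → ℝ) (hf : f (-1) = 0) :
    ∑ y : Fin N, (if (y : ℕ) + 1 = x then f (y : ℝ) else 0) = f ((x : ℝ) - 1) := by
  by_cases h : 1 ≤ (x : ℕ)
  · have hx := x.2
    rw [Finset.sum_eq_single (⟨x - 1, by omega⟩ : Fin N)]
    · simp [h]
    · intro b _ hb
      rw [if_neg]
      intro h'
      apply hb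
      ext
      simp only
      omega
    · simp
  · have h1 : (x : ℕ) = 0 := by omega
    have h2 : (x : ℝ) - 1 = -1 := by simp [h1]
    rw [h2, hf]
    refine Finset.sum_eq_zero fun y _ => ?_
    rw [if_neg]
    omega

theorem potential_topple {x : Fin N} {η : Fin N → ℝ} (hx : 1 ≤ η x) :
    potential (topple x η) = potential η - η x := by
  have hA : ∀ y : Fin N, ((y : ℝ) + 1) * ((N : ℝ) - y) * topple x η y =
      ((y : ℝ) + 1) * ((N : ℝ) - y) * η y
      - (if y = x then ((x : ℝ) + 1) * ((N : ℝ) - x) * η x else 0)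
      + (if (x : ℕ) + 1 = y then ((y : ℝ) + 1) * ((N : ℝ) - y) * (η x / 2) else 0)
      + (if (y : ℕ) + 1 = x then ((y : ℝ) + 1) * ((N : ℝ) - y) * (η x / 2) else 0) := by
    intro y
    unfold topple Adj
    rw [if_pos hx]
    by_cases h1 : y = x
    · subst h1
      simp
    · by_cases h2 : (x : ℕ) + 1 = y
      · have h3 : ¬ ((y : ℕ) + 1 = x) := by omega
        simp only [h1, h2, h3, if_true, if_false, true_or]
        ring
      · by_cases h3 : (y : ℕ) + 1 = x
        · simp only [h1, h2, h3, if_true, if_false, or_true]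
          ring
        · simp [h1, h2, h3]
  unfold potential
  rw [Finset.sum_congr rfl fun y _ => hA y, Finset.sum_add_distrib, Finset.sum_add_distrib,
    Finset.sum_sub_distrib, sum_right x (fun r => (r + 1) * ((N : ℝ) - r) * (η x / 2)) (by ring),
    sum_left x (fun r => (r + 1) * ((N : ℝ) - r) * (η x / 2)) (by ring)]
  simp only [Finset.sum_ite_eq', Finset.mem_univ, if_true]
  ring

theorem potential_topple_le (x : Fin N) (η : Fin N → ℝ) :
    potential (topple x η) ≤ potential η := by
  by_cases hx : 1 ≤ η x
  · rw [potential_topple hx]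
    linarith
  · simp [topple, hx]

theorem foldl_nonneg (l : List (Fin N)) {η : Fin N → ℝ} (h : ∀ y, 0 ≤ η y) (y : Fin N) :
    0 ≤ l.foldl (fun ζ x => topple x ζ) η y := by
  induction l generalizing η with
  | nil => exact h y
  | cons x l ih => exact ih (topple_nonneg x h)

theorem potential_foldl_le (l : List (Fin N)) (η : Fin N → ℝ) :
    potential (l.foldl (fun ζ x => topple x ζ) η) ≤ potential η := by
  induction l generalizing η with
  | nil => exact le_rfl
  | cons x l ih => exact (ih _).trans (potential_topple_le x η)

theorem potential_foldl_le_sub (l : List (Fin N)) {η : Fin N → ℝ} {x : Fin N} (hl : x ∈ l)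
    (hx : 1 ≤ η x) : potential (l.foldl (fun ζ x => topple x ζ) η) ≤ potential η - 1 := by
  induction l generalizing η with
  | nil => simp at hl
  | cons y l ih =>
    by_cases hy : 1 ≤ η y
    · refine (potential_foldl_le l _).trans ?_
      rw [potential_topple hy]
      linarith
    · have hxl : x ∈ l := by
        rcases List.mem_cons.1 hl with h | h
        · exact absurd (h ▸ hx) hy
        · exact h
      have h1 : topple y η = η := by simp [topple, hy]
      rw [List.foldl_cons, h1]
      exact ih hxl hx

theorem iterate_nonneg (n : ℕ) {η : Fin N → ℝ} (h : ∀ y, 0 ≤ η y) (y : Fin N) :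
    0 ≤ (sweep^[n] η) y := by
  induction n generalizing η with
  | zero => exact h y
  | succ n ih => exact ih (foldl_nonneg _ h)

theorem exists_sweep_stable {η : Fin N → ℝ} (h : ∀ y, 0 ≤ η y) :
    ∃ n, (sweep^[n] η) ∈ stableSet N := by
  by_contra hc
  push Not at hc
  have key : ∀ n : ℕ, potential (sweep^[n] η) ≤ potential η - n := by
    intro n
    induction n with
    | zero => simp
    | succ n ih =>
      have hx : ∃ x, 1 ≤ (sweep^[n] η) x := by
        by_contra hx
        push Not at hx
        exact hc n fun x => ⟨iterate_nonneg n h x, hx x⟩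
      obtain ⟨x, hx⟩ := hx
      have := potential_foldl_le_sub (List.finRange N) (List.mem_finRange x) hx
      rw [Function.iterate_succ_apply']
      push_cast
      unfold sweep at this ih ⊢
      linarith
  obtain ⟨n, hn⟩ := exists_nat_gt (potential η)
  have h1 := key n
  have h2 := potential_nonneg (iterate_nonneg n h)
  linarith

/-- Every configuration in `[0, ∞)^N` stabilizes. -/
theorem stabilize_mem {η : Fin N → ℝ} (h : ∀ y, 0 ≤ η y) : stabilize η ∈ stableSet N :=
  Nat.sInf_mem (s := {n | (sweep^[n] η) ∈ stableSet N}) (exists_sweep_stable h)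

theorem reaches_foldl (l : List (Fin N)) (η : Fin N → ℝ) :
    Relation.ReflTransGen TopplesTo η (l.foldl (fun ζ x => topple x ζ) η) := by
  induction l generalizing η with
  | nil => exact Relation.ReflTransGen.refl
  | cons x l ih =>
    by_cases hx : 1 ≤ η x
    · exact Relation.ReflTransGen.head ⟨x, hx, rfl⟩ (ih _)
    · have h1 : topple x η = η := by simp [topple, hx]
      rw [List.foldl_cons, h1]
      exact ih η

/-- `stabilize η` is reached from `η` by successive topplings of unstable sites. -/
theorem reaches_stabilize (η : Fin N → ℝ) :
    Relation.ReflTransGen TopplesTo η (stabilize η) := by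
  unfold stabilize
  generalize sweepCount η = n
  induction n with
  | zero => exact Relation.ReflTransGen.refl
  | succ n ih =>
    rw [Function.iterate_succ_apply']
    exact ih.trans (reaches_foldl _ _)

end Termination

section Abelian

variable {N : ℕ}

/-- The configurations met during the stabilization after one addition: between any two unstable
sites there is an empty one. -/
def Good (η : Fin N → ℝ) : Prop :=
  (∀ x, 0 ≤ η x ∧ η x < 2) ∧
    ∀ x y : Fin N, x < y → 1 ≤ η x → 1 ≤ η y → ∃ z, x < z ∧ z < y ∧ η z = 0

theorem Good.not_adj {η : Fin N → ℝ} (h : Good η) {x y : Fin N} (hx : 1 ≤ η x) (hy : 1 ≤ η y) :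
    ¬ Adj x y := by
  rintro (hxy | hxy)
  · obtain ⟨z, h1, h2, -⟩ := h.2 x y (by rw [Fin.lt_def]; omega) hx hy
    rw [Fin.lt_def] at h1 h2
    omega
  · obtain ⟨z, h1, h2, -⟩ := h.2 y x (by rw [Fin.lt_def]; omega) hy hx
    rw [Fin.lt_def] at h1 h2
    omega

theorem topple_self {x : Fin N} {η : Fin N → ℝ} (hx : 1 ≤ η x) : topple x η x = 0 := by
  simp [topple, hx]

theorem topple_adj {x y : Fin N} {η : Fin N → ℝ} (hx : 1 ≤ η x) (h : Adj x y) :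
    topple x η y = η y + η x / 2 := by
  have : y ≠ x := by
    rintro rfl
    rcases h with h | h <;> omega
  simp [topple, hx, h, this]

theorem topple_far {x y : Fin N} {η : Fin N → ℝ} (hxy : y ≠ x) (h : ¬ Adj x y) :
    topple x η y = η y := by
  unfold topple
  split_ifs
  · simp [hxy, h]
  · rfl

theorem Good.after_topple {η : Fin N → ℝ} (h : Good η) {x : Fin N} (hx : 1 ≤ η x) :
    Good (topple x η) := by
  have hx2 := (h.1 x).2
  refine ⟨fun y => ⟨topple_nonneg x (fun y => (h.1 y).1) y, ?_⟩, ?_⟩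
  · by_cases hy : y = x
    · subst hy
      rw [topple_self hx]
      norm_num
    · by_cases ha : Adj x y
      · have : ¬ 1 ≤ η y := fun hy => h.not_adj hx hy ha
        rw [topple_adj hx ha]
        linarith
      · rw [topple_far hy ha]
        exact (h.1 y).2
  · intro y z hyz hy hz
    have hyx : y ≠ x := by
      rintro rfl
      rw [topple_self hx] at hy
      linarith
    have hzx : z ≠ x := by
      rintro rfl
      rw [topple_self hx] at hz
      linarith
    -- an unstable site after the toppling is an old one away from `x`, or a nonempty neighbour
    have key : ∀ w, w ≠ x → 1 ≤ topple x η w →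
        (Adj x w ∧ η w ≠ 0) ∨ (¬ Adj x w ∧ 1 ≤ η w) := by
      intro w hw h1
      by_cases ha : Adj x w
      · refine Or.inl ⟨ha, fun h0 => ?_⟩
        rw [topple_adj hx ha] at h1
        linarith
      · rw [topple_far hw ha] at h1
        exact Or.inr ⟨ha, h1⟩
    by_cases hm : y < x ∧ x < z
    · exact ⟨x, hm.1, hm.2, topple_self hx⟩
    -- both on the left of `x` or both on the right
    rcases lt_or_gt_of_ne hyx with hy1 | hy1
    · have hz1 : z < x := by
        rcases lt_or_gt_of_ne hzx with h' | h'
        · exact h'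
        · exact absurd ⟨hy1, h'⟩ hm
      have hya : ¬ Adj x y := by
        rw [Fin.lt_def] at *
        unfold Adj
        omega
      have hy0 : 1 ≤ η y := by
        rcases key y hyx hy with h' | h'
        · exact absurd h'.1 hya
        · exact h'.2
      rcases key z hzx hz with ⟨h1, h2⟩ | ⟨h1, h2⟩
      · obtain ⟨w, hw1, hw2, hw0⟩ := h.2 y x hy1 hy0 hx
        have hwz : w ≠ z := by
          rintro rfl
          exact h2 hw0
        have hwz' : (w : ℕ) ≠ z := fun h' => hwz (Fin.ext h')
        have hwa : w < z ∧ ¬ Adj x w := by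
          unfold Adj at *
          rw [Fin.lt_def] at *
          omega
        exact ⟨w, hw1, hwa.1, by rw [topple_far hw2.ne hwa.2]; exact hw0⟩
      · obtain ⟨w, hw1, hw2, hw0⟩ := h.2 y z hyz hy0 h2
        have hwa : ¬ Adj x w := by
          unfold Adj at *
          rw [Fin.lt_def] at *
          omega
        exact ⟨w, hw1, hw2, by rw [topple_far (hw2.trans hz1).ne hwa]; exact hw0⟩
    · have hz1 : x < z := hy1.trans hyz
      have hza : ¬ Adj x z := by
        rw [Fin.lt_def] at *
        unfold Adj
        omega
      have hz0 : 1 ≤ η z := by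
        rcases key z hzx hz with h' | h'
        · exact absurd h'.1 hza
        · exact h'.2
      rcases key y hyx hy with ⟨h1, h2⟩ | ⟨h1, h2⟩
      · obtain ⟨w, hw1, hw2, hw0⟩ := h.2 x z hz1 hx hz0
        have hwy : w ≠ y := by
          rintro rfl
          exact h2 hw0
        have hwy' : (w : ℕ) ≠ y := fun h' => hwy (Fin.ext h')
        have hwa : y < w ∧ ¬ Adj x w := by
          unfold Adj at *
          rw [Fin.lt_def] at *
          omega
        exact ⟨w, hwa.1, hw2, by rw [topple_far hw1.ne' hwa.2]; exact hw0⟩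
      · obtain ⟨w, hw1, hw2, hw0⟩ := h.2 y z hyz h2 hz0
        have hwa : ¬ Adj x w := by
          unfold Adj at *
          rw [Fin.lt_def] at *
          omega
        exact ⟨w, hw1, hw2, by rw [topple_far (hy1.trans hw1).ne' hwa]; exact hw0⟩

theorem topple_comm {η : Fin N → ℝ} (h : Good η) {x y : Fin N} (hxy : x ≠ y) (hx : 1 ≤ η x)
    (hy : 1 ≤ η y) : topple y (topple x η) = topple x (topple y η) := by
  have h1 : ¬ Adj x y := h.not_adj hx hy
  have h2 : ¬ Adj y x := h.not_adj hy hx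
  have e1 : topple x η y = η y := topple_far hxy.symm h1
  have e2 : topple y η x = η x := topple_far hxy h2
  have e3 : 1 ≤ topple x η y := by rw [e1]; exact hy
  have e4 : 1 ≤ topple y η x := by rw [e2]; exact hx
  ext z
  by_cases hzx : z = x
  · subst hzx
    rw [topple_far hxy h2, topple_self hx, topple_self e4]
  by_cases hzy : z = y
  · subst hzy
    rw [topple_far hzx h1, topple_self hy, topple_self e3]
  by_cases ax : Adj x z <;> by_cases ay : Adj y z
  · rw [topple_adj e3 ay, topple_adj e4 ax, topple_adj hx ax, topple_adj hy ay, e1, e2]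
    ring
  · rw [topple_far hzy ay, topple_adj e4 ax, topple_adj hx ax, topple_far hzy ay, e2]
  · rw [topple_adj e3 ay, topple_far hzx ax, topple_far hzx ax, topple_adj hy ay, e1]
  · rw [topple_far hzy ay, topple_far hzx ax, topple_far hzx ax, topple_far hzy ay]

theorem Good.of_reaches {η ξ : Fin N → ℝ} (h : Good η)
    (hr : Relation.ReflTransGen TopplesTo η ξ) :
    Relation.ReflTransGen (fun α β => Good α ∧ TopplesTo α β) η ξ ∧ Good ξ := by
  induction hr with
  | refl => exact ⟨Relation.ReflTransGen.refl, h⟩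
  | tail _ hbc ih =>
    refine ⟨ih.1.tail ⟨ih.2, hbc⟩, ?_⟩
    obtain ⟨x, hx, rfl⟩ := hbc
    exact ih.2.after_topple hx

theorem eq_of_reaches_of_stable {η ξ : Fin N → ℝ} (h : η ∈ stableSet N)
    (hr : Relation.ReflTransGen (fun α β => Good α ∧ TopplesTo α β) η ξ) : ξ = η := by
  rcases Relation.ReflTransGen.cases_head hr with h' | ⟨c, ⟨-, x, hx, -⟩, -⟩
  · exact h'.symm
  · exact absurd hx (not_le.2 (h x).2)

theorem Good.stable_unique {η ξ ζ : Fin N → ℝ} (h : Good η)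
    (h1 : Relation.ReflTransGen TopplesTo η ξ) (hξ : ξ ∈ stableSet N)
    (h2 : Relation.ReflTransGen TopplesTo η ζ) (hζ : ζ ∈ stableSet N) : ξ = ζ := by
  obtain ⟨d, hd1, hd2⟩ := Relation.church_rosser (r := fun α β => Good α ∧ TopplesTo α β) (by
    rintro α β γ ⟨hα, x, hx, rfl⟩ ⟨-, y, hy, rfl⟩
    by_cases hxy : x = y
    · subst hxy
      exact ⟨_, Relation.ReflGen.refl, Relation.ReflTransGen.refl⟩
    · have e1 : topple x α y = α y := topple_far (Ne.symm hxy) (hα.not_adj hx hy)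
      have e2 : topple y α x = α x := topple_far hxy (hα.not_adj hy hx)
      refine ⟨topple y (topple x α), Relation.ReflGen.single ⟨hα.after_topple hx, y, ?_, rfl⟩,
        Relation.ReflTransGen.single ⟨hα.after_topple hy, x, ?_, topple_comm hα hxy hx hy⟩⟩
      · rw [e1]
        exact hy
      · rw [e2]
        exact hx) (h.of_reaches h1).1 (h.of_reaches h2).1
  rw [← eq_of_reaches_of_stable hξ hd1, ← eq_of_reaches_of_stable hζ hd2]

/-- After an addition of at most one to one site of a stable configuration, the result of the
stabilization does not depend on the order of the topplings. -/
theorem eq_stabilize {η ξ : Fin N → ℝ} (hη : η ∈ stableSet N) (x : Fin N) {u : ℝ} (h0 : 0 ≤ u)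
    (h1 : u ≤ 1) (hr : Relation.ReflTransGen TopplesTo (η + Pi.single x u) ξ)
    (hξ : ξ ∈ stableSet N) : ξ = stabilize (η + Pi.single x u) := by
  have hs : ∀ y, y ≠ x → (η + Pi.single x u : Fin N → ℝ) y = η y := by
    intro y hy
    simp [hy]
  have hx : (η + Pi.single x u : Fin N → ℝ) x = η x + u := by simp
  have hb : ∀ y, 0 ≤ (η + Pi.single x u : Fin N → ℝ) y ∧
      (η + Pi.single x u : Fin N → ℝ) y < 2 := by
    intro y
    have := hη y
    by_cases hy : y = x
    · subst hy
      rw [hx]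
      constructor <;> linarith
    · rw [hs y hy]
      constructor <;> linarith
  have hg : Good (η + Pi.single x u : Fin N → ℝ) := by
    refine ⟨hb, fun y z hyz hy hz => ?_⟩
    by_cases hyx : y = x
    · have hzx : z ≠ x := by
        rintro rfl
        exact hyz.ne hyx
      rw [hs z hzx] at hz
      exact absurd hz (not_le.2 (hη z).2)
    · rw [hs y hyx] at hy
      exact absurd hy (not_le.2 (hη y).2)
  exact hg.stable_unique hr hξ (reaches_stabilize _) (stabilize_mem fun y => (hb y).1)

end Abelian

section Measurability

variable {N : ℕ}

theorem measurable_topple (x : Fin N) : Measurable (topple x : (Fin N → ℝ) → Fin N → ℝ) := by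
  unfold topple
  refine Measurable.ite (measurableSet_le measurable_const (measurable_pi_apply x)) ?_ measurable_id
  refine measurable_pi_lambda _ fun y => ?_
  split_ifs
  · exact measurable_const
  · fun_prop
  · fun_prop

theorem measurable_foldl (l : List (Fin N)) :
    Measurable (fun η : Fin N → ℝ => l.foldl (fun ζ x => topple x ζ) η) := by
  induction l with
  | nil => exact measurable_id
  | cons x l ih => exact ih.comp (measurable_topple x)

theorem measurable_iterate_sweep (n : ℕ) :
    Measurable (sweep^[n] : (Fin N → ℝ) → Fin N → ℝ) :=
  Measurable.iterate (measurable_foldl _) n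

theorem measurableSet_stableSet : MeasurableSet (stableSet N) := by
  have : stableSet N = ⋂ x, {η : Fin N → ℝ | 0 ≤ η x ∧ η x < 1} := by
    ext η
    simp [stableSet]
  rw [this]
  exact MeasurableSet.iInter fun x =>
    (measurableSet_le measurable_const (measurable_pi_apply x)).inter
      (measurableSet_lt (measurable_pi_apply x) measurable_const)

theorem measurable_sweepCount : Measurable (sweepCount : (Fin N → ℝ) → ℕ) := by
  have hS : ∀ n, MeasurableSet {η : Fin N → ℝ | (sweep^[n] η) ∈ stableSet N} := fun n =>
    measurable_iterate_sweep n measurableSet_stableSet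
  refine measurable_to_countable' fun k => ?_
  have : (sweepCount : (Fin N → ℝ) → ℕ) ⁻¹' {k} =
      ({η | (sweep^[k] η) ∈ stableSet N} ∩
        ⋂ m : ℕ, ⋂ _ : m < k, {η | (sweep^[m] η) ∈ stableSet N}ᶜ) ∪
      ({_η | k = 0} ∩ ⋂ m : ℕ, {η | (sweep^[m] η) ∈ stableSet N}ᶜ) := by
    ext η
    simp only [Set.mem_preimage, Set.mem_singleton_iff, Set.mem_union, Set.mem_inter_iff,
      Set.mem_ofPred_eq, Set.mem_iInter, Set.mem_compl_iff]
    constructor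
    · intro h
      by_cases hne : ∃ n, (sweep^[n] η) ∈ stableSet N
      · left
        have h1 := Nat.sInf_mem (s := {n | (sweep^[n] η) ∈ stableSet N}) hne
        rw [← h]
        exact ⟨h1, fun m hm => Nat.notMem_of_lt_sInf hm⟩
      · right
        push Not at hne
        refine ⟨?_, hne⟩
        rw [← h]
        unfold sweepCount
        rw [Nat.sInf_eq_zero]
        right
        ext n
        simpa using hne n
    · rintro (⟨h1, h2⟩ | ⟨h1, h2⟩)
      · refine le_antisymm (Nat.sInf_le h1) ?_
        by_contra hlt
        push Not at hlt
        exact h2 _ hlt (Nat.sInf_mem (s := {n | (sweep^[n] η) ∈ stableSet N}) ⟨k, h1⟩)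
      · rw [h1]
        unfold sweepCount
        rw [Nat.sInf_eq_zero]
        right
        ext n
        simpa using h2 n
  rw [this]
  exact ((hS k).inter (MeasurableSet.iInter fun m => MeasurableSet.iInter fun _ =>
    (hS m).compl)).union ((MeasurableSet.const _).inter
      (MeasurableSet.iInter fun m => (hS m).compl))

theorem measurable_stabilize : Measurable (stabilize : (Fin N → ℝ) → Fin N → ℝ) := by
  have h : Measurable (fun p : ℕ × (Fin N → ℝ) => sweep^[p.1] p.2) :=
    measurable_from_prod_countable_right fun n => measurable_iterate_sweep n
  exact h.comp (measurable_sweepCount.prodMk measurable_id)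

end Measurability

/-- One step of the model: add the amount `u` to the site `x` and stabilize. Amounts are
nonnegative; `max u 0` only serves to have a function of all real `u`. -/
noncomputable def step {N : ℕ} (η : Stable N) (x : Fin N) (u : ℝ) : Stable N :=
  ⟨stabilize (η.1 + Pi.single x (max u 0)), stabilize_mem fun y => by
    have h1 := (η.2 y).1
    by_cases h : y = x
    · subst h
      simp only [Pi.add_apply, Pi.single_eq_same]
      positivity
    · simpa [h] using h1⟩

theorem measurable_step {N : ℕ} :
    Measurable (fun p : Stable N × (Fin N × ℝ) => step p.1 p.2.1 p.2.2) := by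
  have h : Measurable (fun q : Fin N × (Stable N × ℝ) => step q.2.1 q.1 q.2.2) := by
    refine measurable_from_prod_countable_right fun x => ?_
    refine Measurable.subtype_mk (measurable_stabilize.comp ?_)
    refine measurable_pi_lambda _ fun y => ?_
    have h1 : Measurable fun q : Stable N × ℝ => q.1.1 y :=
      (measurable_pi_apply y).comp (measurable_subtype_coe.comp measurable_fst)
    have h2 : Measurable fun q : Stable N × ℝ =>
        (Pi.single x (max q.2 0) : Fin N → ℝ) y := by
      by_cases hy : y = x
      · subst hy
        simp only [Pi.single_eq_same]
        fun_prop
      · simp [hy]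
    exact h1.add h2
  exact h.comp ((measurable_fst.comp measurable_snd).prodMk
    (measurable_fst.prodMk (measurable_snd.comp measurable_snd)))

/-- The law of one addition `(X, U)`: `X` uniform on the `N` sites, `U` uniform on `[a, b]`,
independent of each other. -/
noncomputable def additionLaw (N : ℕ) (a b : ℝ) : Measure (Fin N × ℝ) :=
  (uniformOn (Set.univ : Set (Fin N))).prod (volume[|Set.Icc a b])

/-- The transition kernel of Zhang's sandpile model `(N, [a, b])`: from `η` the process moves to
the stabilization of `η` plus `U` at `X`. -/
noncomputable def kernel (N : ℕ) (a b : ℝ) : Kernel (Stable N) (Stable N) where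
  toFun η := (additionLaw N a b).map fun p => step η p.1 p.2
  measurable' := by
    have : SFinite (additionLaw N a b) := by unfold additionLaw; infer_instance
    refine Measure.measurable_of_measurable_coe _ fun s hs => ?_
    have h : ∀ η : Stable N, ((additionLaw N a b).map fun p => step η p.1 p.2) s =
        additionLaw N a b (Prod.mk η ⁻¹'
          ((fun p : Stable N × (Fin N × ℝ) => step p.1 p.2.1 p.2.2) ⁻¹' s)) := by
      intro η
      have hm : Measurable fun p : Fin N × ℝ => step η p.1 p.2 :=
        measurable_step.comp (measurable_prodMk_left (x := η))
      rw [Measure.map_apply hm hs]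
      rfl
    simp_rw [h]
    exact measurable_measure_prodMk_left (measurable_step hs)

/-- The distribution at time `t` of the process with initial distribution `ν`. -/
noncomputable def lawAt (N : ℕ) (a b : ℝ) (ν : Measure (Stable N)) : ℕ → Measure (Stable N)
  | 0 => ν
  | t + 1 => (lawAt N a b ν t).bind (kernel N a b)

/-- The total variation distance `sup_A |μ(A) - ν(A)|`, over measurable `A`, of probability
measures. -/
noncomputable def tvDist {α : Type*} [MeasurableSpace α] (μ ν : Measure α) : ℝ :=
  ⨆ A : {A : Set α // MeasurableSet A}, |μ.real A - ν.real A|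

end Zhang

/-! The chain satisfies Doeblin's condition: some power of its kernel dominates a fixed nonzero
measure (`exists_minorizes`). This alone gives a unique invariant law and geometric convergence to
it in total variation, uniformly in the start (`Minorizes.ergodic`).

The minorization rests on stabilization being linear on full configurations. If site 0 has height in
[1, 2) and all others lie in [1/2, 1), every site topples exactly once, from left to right; the last
site ends empty and the others again lie in [1/2, 1). Followed by a reflection of the line, this is
a linear map `zig`, a sup norm contraction on vectors vanishing at site 0. A round consists of `m +
1` additions to the empty site 0, of total amount g in [1, 2).

Let two copies start in `emptyFirst` and use totals g + γ and g. Their difference moves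
deterministically, from d to zig (d + γ e₀). Contraction makes it small, and small γ cancel what is
left, since the vectors zig^(k+1) e₀ span all vectors vanishing at site 0 (`unitVec_mem_reachable`).
Amounts have a density, so shifts by γ cost only a constant factor, and the laws from all points of
`emptyFirst` dominate a multiple of one measure (`Params.rounds_le`).

It remains to enter `emptyFirst` from everywhere in bounded time (`exists_le_sum_emptyFirst`), by
filling low sites and then toppling, and to exclude periodicity: from near the fixed configuration
of `zig`, returns to `emptyFirst` in both `m + j + 1` and `m + j + 2` steps have positive
probability (`Params.return_filled`, `Params.return_toppled`). Additions close to an irrational c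
make the numbers of additions predictable, because no multiple of c hits a toppling threshold
exactly (`exists_params`). -/

namespace Zhang

open scoped ENNReal

/-! ### Doeblin's theorem for Markov kernels -/

section Ergodic

variable {α : Type*} [MeasurableSpace α]

/-- The action of a kernel on nonnegative functions. -/
noncomputable def avg (P : Kernel α α) (f : α → ℝ≥0∞) : α → ℝ≥0∞ := fun x => ∫⁻ y, f y ∂P x

variable {P : Kernel α α}

theorem measurable_avg {f : α → ℝ≥0∞} (hf : Measurable f) : Measurable (avg P f) :=
  hf.lintegral_kernel

theorem measurable_avg_iterate {f : α → ℝ≥0∞} (hf : Measurable f) (n : ℕ) :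
    Measurable ((avg P)^[n] f) := by
  induction n with
  | zero => exact hf
  | succ n ih =>
    rw [Function.iterate_succ_apply']
    exact measurable_avg ih

theorem avg_add {f : α → ℝ≥0∞} (hf : Measurable f) (g : α → ℝ≥0∞) :
    avg P (f + g) = avg P f + avg P g := by
  ext x
  exact lintegral_add_left hf g

theorem avg_iterate_add {f : α → ℝ≥0∞} (hf : Measurable f) (g : α → ℝ≥0∞) (n : ℕ) :
    (avg P)^[n] (f + g) = (avg P)^[n] f + (avg P)^[n] g := by
  induction n with
  | zero => rfl
  | succ n ih =>
    rw [Function.iterate_succ_apply', ih, avg_add (measurable_avg_iterate hf n)]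
    simp only [Function.iterate_succ_apply']

theorem avg_iterate_const [IsMarkovKernel P] (c : ℝ≥0∞) (n : ℕ) :
    (avg P)^[n] (fun _ => c) = fun _ => c := by
  refine Function.iterate_fixed ?_ n
  ext x
  simp [avg]

theorem avg_iterate_mono (n : ℕ) {f g : α → ℝ≥0∞} (h : f ≤ g) :
    (avg P)^[n] f ≤ (avg P)^[n] g :=
  (show Monotone (avg P) from fun _ _ h _ => lintegral_mono h).iterate n h

theorem avg_iterate_const_mul {f : α → ℝ≥0∞} (hf : Measurable f) (c : ℝ≥0∞) (n : ℕ) :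
    (avg P)^[n] (fun x => c * f x) = fun x => c * (avg P)^[n] f x := by
  induction n with
  | zero => rfl
  | succ n ih =>
    rw [Function.iterate_succ_apply', ih]
    ext x
    rw [Function.iterate_succ_apply']
    exact lintegral_const_mul _ (measurable_avg_iterate hf n)

theorem avg_iterate_sum {ι : Type*} (s : Finset ι) {f : ι → α → ℝ≥0∞}
    (hf : ∀ i, Measurable (f i)) (n : ℕ) :
    (avg P)^[n] (∑ i ∈ s, f i) = ∑ i ∈ s, (avg P)^[n] (f i) := by
  classical
  induction s using Finset.induction_on with
  | empty =>
    induction n with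
    | zero => rfl
    | succ n ih =>
      simp only [Finset.sum_empty] at ih ⊢
      rw [Function.iterate_succ_apply', ih]
      ext x
      simp [avg]
  | insert i s hi ih =>
    rw [Finset.sum_insert hi, Finset.sum_insert hi, avg_iterate_add (hf i), ih]

theorem lintegral_bind_iterate {f : α → ℝ≥0∞} (hf : Measurable f) (ν : Measure α) (n : ℕ) :
    ∫⁻ x, f x ∂((fun μ : Measure α => μ.bind P)^[n] ν) = ∫⁻ x, (avg P)^[n] f x ∂ν := by
  induction n generalizing f with
  | zero => rfl
  | succ n ih =>
    rw [Function.iterate_succ_apply', Measure.lintegral_bind P.measurable.aemeasurable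
      hf.aemeasurable, Function.iterate_succ_apply]
    exact ih (measurable_avg hf)

theorem lintegral_kernel_pow {f : α → ℝ≥0∞} (hf : Measurable f) (n : ℕ) (x : α) :
    ∫⁻ y, f y ∂(P ^ n) x = (avg P)^[n] f x := by
  induction n generalizing x with
  | zero =>
    rw [pow_zero]
    exact lintegral_dirac' x hf
  | succ n ih =>
    rw [pow_succ]
    change ∫⁻ y, f y ∂((P ^ n) ∘ₖ P) x = _
    rw [Kernel.lintegral_comp _ _ _ hf, Function.iterate_succ_apply']
    simp only [ih]
    rfl

/-- `m` is a minorizing measure for the `n`-step transitions. -/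
def Minorizes (P : Kernel α α) (n : ℕ) (m : Measure α) : Prop :=
  ∀ f : α → ℝ≥0∞, Measurable f → ∀ x, ∫⁻ y, f y ∂m ≤ (avg P)^[n] f x

theorem Minorizes.univ_le [IsMarkovKernel P] [Nonempty α] {n : ℕ} {m : Measure α}
    (h : Minorizes P n m) : m Set.univ ≤ 1 := by
  have := h (fun _ => 1) measurable_const (Classical.arbitrary α)
  rwa [avg_iterate_const, lintegral_one] at this

/-- Removing the common part `m` from the `n`-step laws leaves mass `1 - m univ`, so each block of
`n` steps shrinks oscillations by that factor. The complement `g` of `f` is carried along to keep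
the upper bound on `f` within nonnegative functions. -/
theorem Minorizes.le_add [IsMarkovKernel P] [Nonempty α] {n : ℕ} {m : Measure α}
    (h : Minorizes P n m) (k : ℕ) {f g : α → ℝ≥0∞} (hf : Measurable f) (hg : Measurable g)
    {d : ℝ≥0∞} (hd : d ≠ ∞) (hfg : ∀ x, f x + g x = d) (x y : α) :
    (avg P)^[n * k] f x ≤ (avg P)^[n * k] f y + (1 - m Set.univ) ^ k * d := by
  induction k generalizing f g d with
  | zero =>
    simp only [mul_zero, Function.iterate_zero, id_eq, pow_zero, one_mul]
    calc f x ≤ f x + g x := le_self_add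
      _ = d := hfg x
      _ ≤ _ := le_add_self
  | succ k ih =>
    have h1 : m Set.univ ≤ 1 := h.univ_le
    have hsum : ∀ z, (avg P)^[n] f z + (avg P)^[n] g z = d := by
      intro z
      have e : f + g = fun _ => d := funext hfg
      have := congrFun (avg_iterate_add (P := P) hf g n) z
      rw [e, avg_iterate_const] at this
      exact this.symm
    have hI : ∫⁻ z, f z ∂m + ∫⁻ z, g z ∂m = d * m Set.univ := by
      rw [← lintegral_add_left hf]
      simp only [hfg, lintegral_const]
    have hf1 : ∫⁻ z, f z ∂m ≠ ∞ :=
      ne_top_of_le_ne_top (ENNReal.mul_ne_top hd (ne_top_of_le_ne_top ENNReal.one_ne_top h1))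
        (le_self_add.trans hI.le)
    -- The integral against `m` is the same at `x` and at `y`, so only the remainders matter; they
    -- are again complementary, with the smaller constant `(1 - m univ) * d`.
    set F : α → ℝ≥0∞ := fun z => (avg P)^[n] f z - ∫⁻ z, f z ∂m with hF
    set G : α → ℝ≥0∞ := fun z => (avg P)^[n] g z - ∫⁻ z, g z ∂m with hG
    have hFm : Measurable F := (measurable_avg_iterate hf n).sub_const _
    have hGm : Measurable G := (measurable_avg_iterate hg n).sub_const _
    have eF : (avg P)^[n] f = (fun _ => ∫⁻ z, f z ∂m) + F := by
      ext z
      exact (add_tsub_cancel_of_le (h f hf z)).symm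
    have hFG : ∀ z, F z + G z = (1 - m Set.univ) * d := by
      intro z
      rw [ENNReal.sub_mul (fun _ _ => hd), one_mul, mul_comm, ← hI, ← hsum z]
      refine ENNReal.eq_sub_of_add_eq ?_ ?_
      · rw [hI]
        exact ENNReal.mul_ne_top hd (ne_top_of_le_ne_top ENNReal.one_ne_top h1)
      · rw [add_add_add_comm, tsub_add_cancel_of_le (h f hf z), tsub_add_cancel_of_le (h g hg z)]
    have hd' : (1 - m Set.univ) * d ≠ ∞ :=
      ENNReal.mul_ne_top (ne_top_of_le_ne_top ENNReal.one_ne_top tsub_le_self) hd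
    have key := ih hFm hGm hd' hFG
    rw [mul_add, mul_one, Function.iterate_add_apply, eF,
      avg_iterate_add measurable_const F, avg_iterate_const]
    simp only [Pi.add_apply]
    rw [add_assoc]
    gcongr
    rwa [pow_succ, mul_assoc]

/-- The surplus `t - n * k` steps are absorbed into the test function: the averages of the
indicators of `A` and its complement still sum to 1. -/
theorem Minorizes.bind_le_add [IsMarkovKernel P] [Nonempty α] {n : ℕ} {m : Measure α}
    (h : Minorizes P n m) {k t : ℕ} (ht : n * k ≤ t) (μ ν : Measure α) [IsProbabilityMeasure μ]
    [IsProbabilityMeasure ν] {A : Set α} (hA : MeasurableSet A) :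
    ((fun μ : Measure α => μ.bind P)^[t] μ) A ≤
      ((fun μ : Measure α => μ.bind P)^[t] ν) A + (1 - m Set.univ) ^ k := by
  obtain ⟨s, rfl⟩ := Nat.exists_eq_add_of_le ht
  have hm : Measurable (A.indicator (1 : α → ℝ≥0∞)) := measurable_one.indicator hA
  have hm' : Measurable (Aᶜ.indicator (1 : α → ℝ≥0∞)) := measurable_one.indicator hA.compl
  set u := (avg P)^[n * k + s] (A.indicator (1 : α → ℝ≥0∞)) with hu
  have hum : Measurable u := measurable_avg_iterate hm _
  have hle : ∀ x y, u x ≤ u y + (1 - m Set.univ) ^ k := by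
    intro x y
    have := h.le_add k (measurable_avg_iterate (P := P) hm s) (measurable_avg_iterate hm' s)
      ENNReal.one_ne_top (fun z => by
        have := congrFun (avg_iterate_add (P := P) hm (Aᶜ.indicator 1) s) z
        rw [Set.indicator_self_add_compl] at this
        have h1 := congrFun (avg_iterate_const (P := P) 1 s) z
        exact this.symm.trans h1) x y
    rwa [← Function.iterate_add_apply, mul_one] at this
  rw [← lintegral_indicator_one hA, ← lintegral_indicator_one hA, lintegral_bind_iterate hm,
    lintegral_bind_iterate hm]
  change ∫⁻ x, u x ∂μ ≤ ∫⁻ y, u y ∂ν + _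
  have h1 : ∀ y, ∫⁻ x, u x ∂μ ≤ u y + (1 - m Set.univ) ^ k := by
    intro y
    calc ∫⁻ x, u x ∂μ ≤ ∫⁻ _, (u y + (1 - m Set.univ) ^ k) ∂μ := lintegral_mono fun x => hle x y
      _ = _ := by simp
  calc ∫⁻ x, u x ∂μ = ∫⁻ _, (∫⁻ x, u x ∂μ) ∂ν := by simp
    _ ≤ ∫⁻ y, (u y + (1 - m Set.univ) ^ k) ∂ν := lintegral_mono h1
    _ = _ := by rw [lintegral_add_left hum]; simp

theorem bind_iterate_eq_self {μ : Measure α} (h : P.Invariant μ) (t : ℕ) :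
    (fun μ : Measure α => μ.bind P)^[t] μ = μ :=
  Function.iterate_fixed (f := fun μ : Measure α => μ.bind P) h.def t

theorem tendsto_one_sub_pow {β : ℝ≥0∞} (h : β ≠ 0) :
    Filter.Tendsto (fun k : ℕ => (1 - β) ^ k) Filter.atTop (nhds 0) :=
  ENNReal.tendsto_pow_atTop_nhds_zero_of_lt_one (ENNReal.sub_lt_self ENNReal.one_ne_top one_ne_zero h)

/-- Only invariance under `n` steps is assumed, as `exists_invariant` needs; exchanging the roles of
the two measures gives equality. -/
theorem Minorizes.le_of_bind_eq [IsMarkovKernel P] [Nonempty α] {n : ℕ} {m : Measure α}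
    (h : Minorizes P n m) (h0 : m Set.univ ≠ 0) {μ ν : Measure α} [IsProbabilityMeasure μ]
    [IsProbabilityMeasure ν] (hμ : (fun μ : Measure α => μ.bind P)^[n] μ = μ)
    (hν : (fun μ : Measure α => μ.bind P)^[n] ν = ν) : μ ≤ ν := by
  refine Measure.le_iff.2 fun A hA => ?_
  have key : ∀ k : ℕ, μ A ≤ ν A + (1 - m Set.univ) ^ k := by
    intro k
    have := h.bind_le_add (le_refl (n * k)) μ ν hA
    rwa [Function.iterate_mul, Function.iterate_fixed hμ, Function.iterate_fixed hν] at this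
  have := (tendsto_one_sub_pow h0).const_add (ν A)
  rw [add_zero] at this
  exact ge_of_tendsto' this key

theorem bind_iterate_eq_pow (ν : Measure α) (n : ℕ) :
    (fun μ : Measure α => μ.bind P)^[n] ν = ν.bind (P ^ n) := by
  ext A hA
  have hm : Measurable (A.indicator (1 : α → ℝ≥0∞)) := measurable_one.indicator hA
  rw [← lintegral_indicator_one hA, lintegral_bind_iterate hm,
    Measure.bind_apply hA (P ^ n).measurable.aemeasurable]
  simp only [← lintegral_kernel_pow hm, lintegral_indicator_one hA]

theorem isProbabilityMeasure_bind [IsMarkovKernel P] (ν : Measure α) [IsProbabilityMeasure ν] :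
    IsProbabilityMeasure (ν.bind P) := by
  constructor
  rw [Measure.bind_apply MeasurableSet.univ P.measurable.aemeasurable]
  simp

theorem isProbabilityMeasure_bind_iterate [IsMarkovKernel P] (ν : Measure α)
    [IsProbabilityMeasure ν] (t : ℕ) :
    IsProbabilityMeasure ((fun μ : Measure α => μ.bind P)^[t] ν) := by
  induction t with
  | zero => assumption
  | succ t ih =>
    rw [Function.iterate_succ_apply']
    exact isProbabilityMeasure_bind _

theorem Minorizes.le_pow {n : ℕ} {m : Measure α} (h : Minorizes P n m) (x : α) :
    m ≤ (P ^ n) x := by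
  refine Measure.le_iff.2 fun A hA => ?_
  have hm : Measurable (A.indicator (1 : α → ℝ≥0∞)) := measurable_one.indicator hA
  have := h _ hm x
  rwa [← lintegral_kernel_pow hm, lintegral_indicator_one hA, lintegral_indicator_one hA] at this

/-- What remains of the `n`-step transitions after removal of a minorizing measure. -/
noncomputable def residual {n : ℕ} {m : Measure α} [IsFiniteMeasure m] (h : Minorizes P n m) :
    Kernel α α where
  toFun x := (P ^ n) x - m
  measurable' := by
    refine Measure.measurable_of_measurable_coe _ fun s hs => ?_
    simp only [Measure.sub_apply hs (h.le_pow _)]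
    exact ((P ^ n).measurable_coe hs).sub_const _

theorem residual_apply_add {n : ℕ} {m : Measure α} [IsFiniteMeasure m] (h : Minorizes P n m)
    (x : α) {A : Set α} (hA : MeasurableSet A) : residual h x A + m A = (P ^ n) x A := by
  change ((P ^ n) x - m) A + m A = _
  rw [Measure.sub_apply hA (h.le_pow x), tsub_add_cancel_of_le (h.le_pow x A)]

theorem pow_apply_univ [IsMarkovKernel P] (n : ℕ) (x : α) : (P ^ n) x Set.univ = 1 := by
  have := lintegral_kernel_pow (P := P) (f := fun _ => 1) measurable_const n x
  rwa [avg_iterate_const, lintegral_one] at this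

/-- Regeneration series: with R the residual kernel, so that P^n = R + m, the measure μ = ∑ₖ m Rᵏ
has mass 1 by the geometric series, and μ P^n = μ R + m = μ. No compactness is involved. -/
theorem Minorizes.exists_bind_eq [IsMarkovKernel P] [Nonempty α] {n : ℕ} {m : Measure α}
    (h : Minorizes P n m) (h0 : m Set.univ ≠ 0) :
    ∃ μ : Measure α, IsProbabilityMeasure μ ∧ (fun μ : Measure α => μ.bind P)^[n] μ = μ := by
  have h1 : m Set.univ ≤ 1 := h.univ_le
  have : IsFiniteMeasure m := ⟨h1.trans_lt ENNReal.one_lt_top⟩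
  set l : ℕ → Measure α := fun k => (fun μ : Measure α => μ.bind (residual h))^[k] m with hl
  have hsucc : ∀ k, l (k + 1) = (l k).bind (residual h) := fun k =>
    Function.iterate_succ_apply' _ _ _
  have hres : ∀ x, residual h x Set.univ = 1 - m Set.univ := by
    intro x
    have := residual_apply_add h x MeasurableSet.univ
    rw [pow_apply_univ] at this
    exact ENNReal.eq_sub_of_add_eq (measure_ne_top _ _) this
  have hmass : ∀ k, l k Set.univ = m Set.univ * (1 - m Set.univ) ^ k := by
    intro k
    induction k with
    | zero => simp [hl]
    | succ k ih =>
      rw [hsucc, Measure.bind_apply MeasurableSet.univ (residual h).measurable.aemeasurable]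
      simp only [hres, lintegral_const, ih]
      ring
  have huniv : Measure.sum l Set.univ = 1 := by
    rw [Measure.sum_apply _ MeasurableSet.univ]
    simp only [hmass]
    rw [ENNReal.tsum_mul_left, ENNReal.tsum_geometric, ENNReal.sub_sub_cancel ENNReal.one_ne_top h1,
      ENNReal.mul_inv_cancel h0 (measure_ne_top _ _)]
  refine ⟨Measure.sum l, ⟨huniv⟩, ?_⟩
  rw [bind_iterate_eq_pow]
  ext A hA
  rw [Measure.bind_apply hA (P ^ n).measurable.aemeasurable]
  simp only [← residual_apply_add h _ hA]
  rw [lintegral_add_right _ measurable_const, lintegral_const, huniv, mul_one,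
    lintegral_sum_measure, Measure.sum_apply _ hA, tsum_eq_zero_add' (f := fun k => l k A)
      ENNReal.summable, add_comm]
  congr 1
  refine tsum_congr fun k => ?_
  rw [hsucc, Measure.bind_apply hA (residual h).measurable.aemeasurable]

/-- If μ is invariant under `n` steps, so is `μ.bind P`; uniqueness for `n` steps identifies the
two. -/
theorem Minorizes.exists_invariant [IsMarkovKernel P] [Nonempty α] {n : ℕ} {m : Measure α}
    (h : Minorizes P n m) (h0 : m Set.univ ≠ 0) :
    ∃ μ : Measure α, IsProbabilityMeasure μ ∧ P.Invariant μ := by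
  obtain ⟨μ, hμ, he⟩ := h.exists_bind_eq h0
  have h2 : (fun μ : Measure α => μ.bind P)^[n] (μ.bind P) = μ.bind P := by
    rw [← Function.iterate_succ_apply (fun μ : Measure α => μ.bind P), Function.iterate_succ_apply',
      he]
  have := isProbabilityMeasure_bind (P := P) μ
  exact ⟨μ, hμ, le_antisymm (h.le_of_bind_eq h0 h2 he) (h.le_of_bind_eq h0 he h2)⟩

theorem tvDist_nonneg (μ ν : Measure α) : 0 ≤ tvDist μ ν :=
  Real.iSup_nonneg fun _ => abs_nonneg _

theorem tvDist_le {μ ν : Measure α} [IsFiniteMeasure μ] [IsFiniteMeasure ν] {d : ℝ≥0∞}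
    (hd : d ≠ ∞) (h1 : ∀ A, MeasurableSet A → μ A ≤ ν A + d)
    (h2 : ∀ A, MeasurableSet A → ν A ≤ μ A + d) : tvDist μ ν ≤ d.toReal := by
  refine Real.iSup_le (fun A => ?_) ENNReal.toReal_nonneg
  have key : ∀ (μ ν : Measure α) [IsFiniteMeasure μ] [IsFiniteMeasure ν],
      μ A.1 ≤ ν A.1 + d → μ.real A.1 ≤ ν.real A.1 + d.toReal := by
    intro μ ν _ _ h
    unfold Measure.real
    rw [← ENNReal.toReal_add (measure_ne_top _ _) hd]
    exact ENNReal.toReal_mono (ENNReal.add_ne_top.2 ⟨measure_ne_top _ _, hd⟩) h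
  have a1 := key μ ν (h1 _ A.2)
  have a2 := key ν μ (h2 _ A.2)
  rw [abs_le]
  constructor <;> linarith

/-- A Markov kernel with a minorization has a unique invariant probability measure, to which
its iterates converge in total variation. -/
theorem Minorizes.ergodic [IsMarkovKernel P] [Nonempty α] {n : ℕ} {m : Measure α}
    (h : Minorizes P n m) (h0 : m Set.univ ≠ 0) :
    ∃ μ : Measure α, IsProbabilityMeasure μ ∧ P.Invariant μ ∧
      (∀ μ' : Measure α, IsProbabilityMeasure μ' → P.Invariant μ' → μ' = μ) ∧
      ∀ ν : Measure α, IsProbabilityMeasure ν → Filter.Tendsto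
        (fun t : ℕ => tvDist ((fun μ : Measure α => μ.bind P)^[t] ν) μ) Filter.atTop (nhds 0) := by
  obtain ⟨μ, hμ, hinv⟩ := h.exists_invariant h0
  refine ⟨μ, hμ, hinv, fun μ' hμ' hinv' => ?_, fun ν hν => ?_⟩
  · exact le_antisymm
      (h.le_of_bind_eq h0 (bind_iterate_eq_self hinv' n) (bind_iterate_eq_self hinv n))
      (h.le_of_bind_eq h0 (bind_iterate_eq_self hinv n) (bind_iterate_eq_self hinv' n))
  · have hne : ∀ k : ℕ, (1 - m Set.univ) ^ k ≠ ∞ := fun k =>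
      ENNReal.pow_ne_top (ne_top_of_le_ne_top ENNReal.one_ne_top tsub_le_self)
    have hbound : ∀ k t : ℕ, n * k ≤ t →
        tvDist ((fun μ : Measure α => μ.bind P)^[t] ν) μ ≤ ((1 - m Set.univ) ^ k).toReal := by
      intro k t ht
      have := isProbabilityMeasure_bind_iterate (P := P) ν t
      refine tvDist_le (hne k) (fun A hA => ?_) fun A hA => ?_
      · have := h.bind_le_add ht ν μ hA
        rwa [bind_iterate_eq_self hinv] at this
      · have := h.bind_le_add ht μ ν hA
        rwa [bind_iterate_eq_self hinv] at this
    have hlim : Filter.Tendsto (fun k : ℕ => ((1 - m Set.univ) ^ k).toReal) Filter.atTop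
        (nhds 0) := by
      exact (ENNReal.tendsto_toReal ENNReal.zero_ne_top).comp (tendsto_one_sub_pow h0)
    rw [Metric.tendsto_atTop]
    intro ε hε
    obtain ⟨k, hk⟩ := (hlim.eventually (gt_mem_nhds hε)).exists
    refine ⟨n * k, fun t ht => ?_⟩
    rw [Real.dist_eq, sub_zero, abs_of_nonneg (tvDist_nonneg _ _)]
    exact (hbound k t ht).trans_lt hk

/-! ### From hitting and aperiodicity to a minorization -/

/-- Take `j = n % p` and `i = n / p - n % p`, which is nonnegative because `n / p ≥ p`. -/
theorem exists_mul_add_mul_succ (p n : ℕ) (h : p * p ≤ n) : ∃ i j : ℕ, n = i * p + j * (p + 1) := by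
  rcases Nat.eq_zero_or_pos p with rfl | hp
  · exact ⟨0, n, by simp⟩
  · have h1 : n % p < p := Nat.mod_lt _ hp
    have h2 : p ≤ n / p := (Nat.le_div_iff_mul_le hp).2 h
    obtain ⟨i, hi⟩ := Nat.exists_eq_add_of_le (h1.le.trans h2)
    refine ⟨i, n % p, ?_⟩
    have h3 := Nat.div_add_mod n p
    rw [hi] at h3
    nlinarith

theorem const_mul_le_avg_iterate {E : Set α} (hE : MeasurableSet E) {g : α → ℝ≥0∞} {c : ℝ≥0∞}
    (h : ∀ y ∈ E, c ≤ g y) (t : ℕ) (x : α) :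
    c * (avg P)^[t] (E.indicator 1) x ≤ (avg P)^[t] g x := by
  have h1 := avg_iterate_const_mul (P := P) (measurable_one.indicator hE) c t
  rw [← congrFun h1 x]
  refine avg_iterate_mono t (fun y => ?_) x
  by_cases hy : y ∈ E
  · simpa [hy] using h y hy
  · simp [hy]

theorem mul_measure_le_lintegral {C : Set α} (hC : MeasurableSet C) {ρ : Measure α}
    {g : α → ℝ≥0∞} {c : ℝ≥0∞} (h : ∀ y ∈ C, c ≤ g y) : c * ρ C ≤ ∫⁻ y, g y ∂ρ := by
  rw [← lintegral_indicator_const hC]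
  refine lintegral_mono fun y => ?_
  by_cases hy : y ∈ C
  · simpa [hy] using h y hy
  · simp [hy]

theorem exists_uniform_const {p : ℕ → ℝ≥0∞ → Prop} (hp : ∀ n δ δ', δ' ≤ δ → p n δ → p n δ')
    (T : ℕ) (h : ∀ t < T, ∃ δ, δ ≠ 0 ∧ p t δ) : ∃ δ, δ ≠ 0 ∧ ∀ t < T, p t δ := by
  induction T with
  | zero => exact ⟨1, one_ne_zero, by simp⟩
  | succ T ih =>
    obtain ⟨δ, h1, h2⟩ := ih fun t ht => h t (by omega)
    obtain ⟨δ', h1', h2'⟩ := h T (by omega)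
    refine ⟨min δ δ', ?_, fun t ht => ?_⟩
    · rw [← pos_iff_ne_zero] at *
      exact lt_min h1 h1'
    · rcases Nat.lt_succ_iff_lt_or_eq.1 ht with h3 | rfl
      · exact hp _ _ _ (min_le_left _ _) (h2 t h3)
      · exact hp _ _ _ (min_le_right _ _) h2'

/-- If `E` is hit from everywhere within bounded time, the `l`-step transitions from `E` are
minorized by a measure that charges `C ⊆ E`, and from `C` one can return to `E` at two successive
times, then some power of the kernel has a minorization. -/
theorem exists_minorizes_of_hitting {C E : Set α} (hC : MeasurableSet C) (hE : MeasurableSet E)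
    (hCE : C ⊆ E) {ρ : Measure α} (hρ : ρ C ≠ 0) {q : ℝ≥0∞} (hq : q ≠ 0) {T l r : ℕ}
    (hhit : ∀ x, q ≤ ∑ t ∈ Finset.range T, (avg P)^[t] (E.indicator 1) x)
    (hmin : ∀ x ∈ E, ∀ f : α → ℝ≥0∞, Measurable f → q * ∫⁻ y, f y ∂ρ ≤ (avg P)^[l] f x)
    (hr : ∀ x ∈ C, q ≤ (avg P)^[r] (E.indicator 1) x)
    (hr' : ∀ x ∈ C, q ≤ (avg P)^[r + 1] (E.indicator 1) x) :
    ∃ n, ∃ δ : ℝ≥0∞, δ ≠ 0 ∧ Minorizes P n (δ • ρ) := by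
  -- The times `s` that are good for some positive `δ` contain `l` and are closed under adding `r +
  -- l` and `r + l + 1`; hence they contain all large times.
  set good : ℕ → ℝ≥0∞ → Prop := fun s δ =>
    ∀ x ∈ C, ∀ f : α → ℝ≥0∞, Measurable f → δ * ∫⁻ y, f y ∂ρ ≤ (avg P)^[s] f x with hgood
  have hmono : ∀ n δ δ', δ' ≤ δ → good n δ → good n δ' := fun n δ δ' h h1 x hx f hf =>
    (mul_le_mul_left h _).trans (h1 x hx f hf)
  have hEs : ∀ s δ, good s δ → ∀ x ∈ E, ∀ f : α → ℝ≥0∞, Measurable f →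
      q * ρ C * δ * ∫⁻ y, f y ∂ρ ≤ (avg P)^[l] ((avg P)^[s] f) x := by
    intro s δ hs x hx f hf
    refine le_trans ?_ (hmin x hx _ (measurable_avg_iterate hf s))
    have := mul_measure_le_lintegral (ρ := ρ) hC fun y hy => hs y hy f hf
    calc q * ρ C * δ * ∫⁻ y, f y ∂ρ = q * ((δ * ∫⁻ y, f y ∂ρ) * ρ C) := by ring
      _ ≤ _ := by gcongr
  -- From `C` go to `E` in `r` steps, then in `l` steps back to `C`, which `ρ` charges, and spend
  -- the remaining `s` steps from there.
  have hstep : ∀ r, (∀ x ∈ C, q ≤ (avg P)^[r] (E.indicator 1) x) → ∀ s,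
      (∃ δ, δ ≠ 0 ∧ good s δ) → ∃ δ, δ ≠ 0 ∧ good (r + l + s) δ := by
    rintro r hr s ⟨δ, hδ, hs⟩
    refine ⟨q * ρ C * δ * q, by simp [hq, hρ, hδ], fun x hx f hf => ?_⟩
    rw [add_assoc, Function.iterate_add_apply, Function.iterate_add_apply]
    refine le_trans ?_ (const_mul_le_avg_iterate hE (fun y hy => hEs s δ hs y hy f hf) r x)
    calc q * ρ C * δ * q * ∫⁻ y, f y ∂ρ = q * ρ C * δ * (∫⁻ y, f y ∂ρ) * q := by ring
      _ ≤ _ := by gcongr; exact hr x hx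
  have hall : ∀ i j : ℕ, ∃ δ, δ ≠ 0 ∧ good (l + (i * (r + l) + j * (r + l + 1))) δ := by
    intro i
    induction i with
    | zero =>
      intro j
      induction j with
      | zero => exact ⟨q, hq, fun x hx f hf => by simpa using hmin x (hCE hx) f hf⟩
      | succ j ih =>
        have := hstep (r + 1) hr' _ ih
        rwa [show l + (0 * (r + l) + (j + 1) * (r + l + 1)) =
          r + 1 + l + (l + (0 * (r + l) + j * (r + l + 1))) by ring]
    | succ i ih =>
      intro j
      have := hstep r hr _ (ih j)
      rwa [show l + ((i + 1) * (r + l) + j * (r + l + 1)) =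
        r + l + (l + (i * (r + l) + j * (r + l + 1))) by ring]
  have hlarge : ∀ s, l + (r + l) * (r + l) ≤ s → ∃ δ, δ ≠ 0 ∧ good s δ := by
    intro s hs
    obtain ⟨u, rfl⟩ := Nat.exists_eq_add_of_le ((Nat.le_add_right _ _).trans hs)
    obtain ⟨i, j, rfl⟩ := exists_mul_add_mul_succ (r + l) u (by omega)
    exact hall i j
  -- After a hit of `E` at any time `t < T` and `l` further steps, the time left still exceeds the
  -- threshold in `hlarge`.
  set n := T + l + (l + (r + l) * (r + l)) with hn
  obtain ⟨δ, hδ, hδ'⟩ := exists_uniform_const (p := fun t δ => good (n - l - t) δ)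
    (fun t => hmono _) T fun t ht => hlarge _ (by omega)
  -- Each of the `T` possible hitting times gives a lower bound for the same quantity; adding them
  -- up costs the division by `T`.
  refine ⟨n, q * ρ C * δ * q / T, ?_, fun f hf x => ?_⟩
  · simp [hq, hρ, hδ, ENNReal.div_eq_zero_iff]
  · rw [lintegral_smul_measure, smul_eq_mul]
    have key : ∀ t ∈ Finset.range T,
        q * ρ C * δ * (∫⁻ y, f y ∂ρ) * (avg P)^[t] (E.indicator 1) x ≤ (avg P)^[n] f x := by
      intro t ht
      rw [Finset.mem_range] at ht
      have e : n = t + (l + (n - l - t)) := by omega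
      rw [e, Function.iterate_add_apply, Function.iterate_add_apply]
      exact const_mul_le_avg_iterate hE (fun y hy => hEs _ δ (hδ' t ht) y hy f hf) t x
    have hT : T ≠ 0 := by
      rintro rfl
      exact hq (by simpa using hhit x)
    have hsum := Finset.sum_le_sum key
    rw [← Finset.mul_sum, Finset.sum_const, Finset.card_range, nsmul_eq_mul] at hsum
    rw [ENNReal.mul_comm_div, ← mul_div_assoc]
    refine ENNReal.div_le_of_le_mul ?_
    rw [mul_comm _ (T : ℝ≥0∞)]
    refine le_trans ?_ hsum
    calc q * ρ C * δ * q * ∫⁻ y, f y ∂ρ = q * ρ C * δ * (∫⁻ y, f y ∂ρ) * q := by ring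
      _ ≤ _ := by gcongr; exact hhit x

end Ergodic

/-! ### Sweeps of full configurations -/

section Dynamics

variable {N : ℕ}

/-- The height of site `k`, as a linear functional; zero outside the line. -/
noncomputable def coord (k : ℕ) : (Fin N → ℝ) →ₗ[ℝ] ℝ :=
  if h : k < N then LinearMap.proj ⟨k, h⟩ else 0

theorem coord_apply (i : Fin N) (w : Fin N → ℝ) : coord (i : ℕ) w = w i := by
  simp [coord]

/-- The height at which site `k` topples when the sites topple one after the other from left to
right. -/
noncomputable def acc : ℕ → ((Fin N → ℝ) →ₗ[ℝ] ℝ)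
  | 0 => coord 0
  | k + 1 => coord (k + 1) + (1 / 2 : ℝ) • acc k

theorem acc_zero (w : Fin N → ℝ) : acc 0 w = coord 0 w := rfl

theorem acc_succ (k : ℕ) (w : Fin N → ℝ) : acc (k + 1) w = coord (k + 1) w + acc k w / 2 := by
  simp only [acc, LinearMap.add_apply, LinearMap.smul_apply, smul_eq_mul]
  ring

/-- The configuration after one toppling at each of the sites smaller than `q`. -/
noncomputable def partialSweep (q : ℕ) (w : Fin N → ℝ) (i : Fin N) : ℝ :=
  if (i : ℕ) + 1 < q then acc ((i : ℕ) + 1) w / 2 else if (i : ℕ) + 1 = q then 0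
  else if (i : ℕ) = q then acc q w else w i

/-- The configuration after one toppling at each site, from left to right. -/
noncomputable def afterSweep (w : Fin N → ℝ) (i : Fin N) : ℝ :=
  if (i : ℕ) + 1 < N then acc ((i : ℕ) + 1) w / 2 else 0

theorem partialSweep_full (w : Fin N → ℝ) : partialSweep N w = afterSweep w := by
  ext i
  have := i.2
  unfold partialSweep afterSweep
  by_cases h : (i : ℕ) + 1 < N
  · simp [h]
  · have h' : (i : ℕ) + 1 = N := by omega
    simp [h']

theorem topple_partialSweep (q : Fin N) (w : Fin N → ℝ) (hq : 1 ≤ acc (q : ℕ) w) :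
    topple q (partialSweep (q : ℕ) w) = partialSweep ((q : ℕ) + 1) w := by
  have e : partialSweep (q : ℕ) w q = acc (q : ℕ) w := by simp [partialSweep]
  have hu : 1 ≤ partialSweep (q : ℕ) w q := by rwa [e]
  ext i
  by_cases h1 : i = q
  · subst h1
    rw [topple_self hu]
    simp [partialSweep]
  have h1' : (i : ℕ) ≠ q := fun h => h1 (Fin.ext h)
  by_cases h2 : Adj q i
  · rw [topple_adj hu h2, e]
    rcases h2 with h2 | h2
    · have hc : coord ((q : ℕ) + 1) w = w i := by rw [h2, coord_apply]
      unfold partialSweep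
      rw [if_neg (by omega), if_neg (by omega), if_neg h1', if_neg (by omega), if_neg (by omega),
        if_pos h2.symm, acc_succ, hc]
    · unfold partialSweep
      rw [if_neg (by omega), if_pos h2, if_pos (by omega), h2]
      ring
  · rw [topple_far h1 h2]
    unfold Adj at h2
    push Not at h2
    unfold partialSweep
    by_cases h3 : (i : ℕ) + 1 < q
    · rw [if_pos h3, if_pos (by omega)]
    · rw [if_neg h3, if_neg (by omega), if_neg h1', if_neg (by omega), if_neg (by omega),
        if_neg (by omega)]

/-- From site `p` on the line is full, site `p` is unstable, and what lies to the left of `p` is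
at most one empty site. -/
structure SweepReady (p : ℕ) (w : Fin N → ℝ) : Prop where
  lt : p < N
  left : p = 0 ∨ (p = 1 ∧ coord 0 w = 0)
  one_le : 1 ≤ coord p w
  lt_two : coord p w < 2
  half_le : ∀ i : Fin N, p < i → 1 / 2 ≤ w i
  lt_one : ∀ i : Fin N, p < i → w i < 1

/-- An empty site 0 passes nothing on, so the formulas for a sweep starting at site 0 also describe
one starting at site 1. -/
theorem SweepReady.acc_self {p : ℕ} {w : Fin N → ℝ} (h : SweepReady p w) :
    acc p w = coord p w := by
  rcases h.left with rfl | ⟨rfl, h0⟩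
  · rfl
  · rw [acc_succ, acc_zero, h0]
    simp

/-- The interval [1, 2) reproduces itself: half of such a height lies in [1/2, 1), and so does the
height of the next site. -/
theorem SweepReady.acc_mem {p : ℕ} {w : Fin N → ℝ} (h : SweepReady p w) (d : ℕ)
    (hd : p + d < N) : 1 ≤ acc (p + d) w ∧ acc (p + d) w < 2 := by
  induction d with
  | zero =>
    rw [add_zero, h.acc_self]
    exact ⟨h.one_le, h.lt_two⟩
  | succ d ih =>
    have h1 := ih (by omega)
    have h2 := h.half_le ⟨p + d + 1, hd⟩ (by simp only; omega)
    have h3 := h.lt_one ⟨p + d + 1, hd⟩ (by simp only; omega)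
    rw [← add_assoc, acc_succ, coord_apply ⟨p + d + 1, hd⟩ w]
    constructor <;> linarith [h1.1, h1.2]

theorem SweepReady.partialSweep_self {p : ℕ} {w : Fin N → ℝ} (h : SweepReady p w) :
    partialSweep p w = w := by
  ext i
  unfold partialSweep
  rw [h.acc_self]
  rcases h.left with rfl | ⟨rfl, h0⟩
  · by_cases hi : (i : ℕ) = 0
    · have := coord_apply i w
      rw [hi] at this
      simp [hi, this]
    · simp [hi]
  · by_cases hi : (i : ℕ) = 0
    · have := coord_apply i w
      rw [hi, h0] at this
      simp [hi, this]
    · by_cases hi1 : (i : ℕ) = 1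
      · have := coord_apply i w
        rw [hi1] at this
        simp [hi1, this]
      · simp [hi, hi1]

theorem SweepReady.reaches {p : ℕ} {w : Fin N → ℝ} (h : SweepReady p w) :
    Relation.ReflTransGen TopplesTo w (afterSweep w) := by
  have key : ∀ d, p + d ≤ N → Relation.ReflTransGen TopplesTo w (partialSweep (p + d) w) := by
    intro d
    induction d with
    | zero =>
      intro _
      rw [add_zero, h.partialSweep_self]
    | succ d ih =>
      intro hd
      have h1 := (h.acc_mem d (by omega)).1
      refine (ih (by omega)).tail ⟨⟨p + d, by omega⟩, ?_, ?_⟩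
      · simpa [partialSweep] using h1
      · exact (topple_partialSweep ⟨p + d, by omega⟩ w h1).symm
  have := key (N - p) (by have := h.lt; omega)
  rwa [show p + (N - p) = N by have := h.lt; omega, partialSweep_full] at this

theorem SweepReady.afterSweep_mem {p : ℕ} {w : Fin N → ℝ} (h : SweepReady p w) (i : Fin N)
    (hi : (i : ℕ) + 1 < N) : 1 / 2 ≤ afterSweep w i ∧ afterSweep w i < 1 := by
  have hp : p ≤ (i : ℕ) + 1 := by rcases h.left with h | h <;> omega
  obtain ⟨d, hd⟩ := Nat.exists_eq_add_of_le hp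
  have := h.acc_mem d (by omega)
  unfold afterSweep
  rw [if_pos hi, hd]
  constructor <;> linarith [this.1, this.2]

theorem SweepReady.afterSweep_stable {p : ℕ} {w : Fin N → ℝ} (h : SweepReady p w) :
    afterSweep w ∈ stableSet N := by
  intro i
  by_cases hi : (i : ℕ) + 1 < N
  · have := h.afterSweep_mem i hi
    constructor <;> linarith [this.1, this.2]
  · simp [afterSweep, hi]

theorem good_add {η : Fin N → ℝ} (hη : η ∈ stableSet N) (x : Fin N) {u : ℝ} (h0 : 0 ≤ u)
    (h2 : η x + u < 2) : Good (η + Pi.single x u) := by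
  have hs : ∀ y, y ≠ x → (η + Pi.single x u : Fin N → ℝ) y = η y := by
    intro y hy
    simp [hy]
  refine ⟨fun y => ?_, fun y z hyz hy hz => ?_⟩
  · have := hη y
    by_cases hy : y = x
    · subst hy
      simp only [Pi.add_apply, Pi.single_eq_same]
      constructor <;> linarith
    · rw [hs y hy]
      constructor <;> linarith
  · by_cases hyx : y = x
    · have hzx : z ≠ x := by
        rintro rfl
        exact hyz.ne hyx
      rw [hs z hzx] at hz
      exact absurd hz (not_le.2 (hη z).2)
    · rw [hs y hyx] at hy
      exact absurd hy (not_le.2 (hη y).2)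

/-- The abelian property allows stabilizations to be computed with any convenient order of
topplings. -/
theorem Good.stabilize_eq {w ξ : Fin N → ℝ} (h : Good w)
    (hr : Relation.ReflTransGen TopplesTo w ξ) (hξ : ξ ∈ stableSet N) : stabilize w = ξ :=
  h.stable_unique (reaches_stabilize w) (stabilize_mem fun y => (h.1 y).1) hr hξ

theorem stabilize_of_stable {w : Fin N → ℝ} (h : w ∈ stableSet N) : stabilize w = w := by
  have hg : Good w := ⟨fun x => ⟨(h x).1, by linarith [(h x).2]⟩, fun x _ _ hx =>
    absurd hx (not_le.2 (h x).2)⟩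
  exact hg.stabilize_eq Relation.ReflTransGen.refl h

theorem step_val (η : Stable N) (x : Fin N) {u : ℝ} (h0 : 0 ≤ u) :
    (step η x u).1 = stabilize (η.1 + Pi.single x u) := by
  simp [step, max_eq_left h0]

theorem step_of_lt_one (η : Stable N) (x : Fin N) {u : ℝ} (h0 : 0 ≤ u) (h1 : η.1 x + u < 1) :
    (step η x u).1 = η.1 + Pi.single x u := by
  rw [step_val η x h0]
  refine stabilize_of_stable fun y => ?_
  have := η.2 y
  by_cases hy : y = x
  · subst hy
    simp only [Pi.add_apply, Pi.single_eq_same]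
    constructor <;> linarith
  · simpa [hy] using this

theorem step_sweep (η : Stable N) (x : Fin N) {u : ℝ} (h0 : 0 ≤ u) {p : ℕ} (hp : p = x)
    (h : SweepReady p (η.1 + Pi.single x u)) :
    (step η x u).1 = afterSweep (η.1 + Pi.single x u) := by
  rw [step_val η x h0]
  refine (good_add η.2 x h0 ?_).stabilize_eq h.reaches h.afterSweep_stable
  have := h.lt_two
  rw [hp, coord_apply] at this
  simpa using this

/-- Additions to one site act through their sum, as long as only the last one causes topplings. -/
theorem step_add (η ξ : Stable N) (x : Fin N) {s u : ℝ} (hs : 0 ≤ s) (hu : 0 ≤ u)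
    (hξ : ξ.1 = η.1 + Pi.single x s) : step ξ x u = step η x (s + u) := by
  apply Subtype.ext
  rw [step_val ξ x hu, step_val η x (add_nonneg hs hu), hξ, add_assoc, ← Pi.single_add]

/-- Site `0` is empty, all others are full. -/
def emptyFirst (N : ℕ) : Set (Stable N) :=
  {η | ∀ i : Fin N, ((i : ℕ) = 0 → η.1 i = 0) ∧ ((i : ℕ) ≠ 0 → 1 / 2 ≤ η.1 i)}

/-- Site `N - 1` is empty, all others are full. -/
def emptyLast (N : ℕ) : Set (Stable N) :=
  {η | ∀ i : Fin N, ((i : ℕ) + 1 = N → η.1 i = 0) ∧ ((i : ℕ) + 1 ≠ N → 1 / 2 ≤ η.1 i)}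

theorem step_sweep_mem (η : Stable N) (x : Fin N) {u : ℝ} (h0 : 0 ≤ u) {p : ℕ} (hp : p = x)
    (h : SweepReady p (η.1 + Pi.single x u)) : step η x u ∈ emptyLast N := by
  intro i
  rw [step_sweep η x h0 hp h]
  constructor
  · intro hi
    simp [afterSweep, hi]
  · intro hi
    exact (h.afterSweep_mem i (by have := i.2; omega)).1

/-! ### Reflection of the line -/

theorem adj_rev {x y : Fin N} : Adj x.rev y.rev ↔ Adj x y := by
  have := x.2
  have := y.2
  unfold Adj
  simp only [Fin.val_rev]
  omega

theorem topple_rev (x : Fin N) (η : Fin N → ℝ) :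
    topple x.rev (η ∘ Fin.rev) = topple x η ∘ Fin.rev := by
  ext y
  obtain ⟨z, rfl⟩ := Fin.rev_surjective y
  by_cases h : 1 ≤ η x
  · have h' : 1 ≤ (η ∘ Fin.rev) x.rev := by simpa using h
    rw [Function.comp_apply, Fin.rev_rev]
    by_cases hz : z = x
    · subst hz
      rw [topple_self h, topple_self h']
    · by_cases ha : Adj x z
      · rw [topple_adj h ha, topple_adj h' (adj_rev.2 ha)]
        simp
      · rw [topple_far hz ha, topple_far (by simpa using hz) (by rwa [adj_rev])]
        simp
  · simp [topple, h]

theorem reaches_rev {η ξ : Fin N → ℝ} (h : Relation.ReflTransGen TopplesTo η ξ) :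
    Relation.ReflTransGen TopplesTo (η ∘ Fin.rev) (ξ ∘ Fin.rev) := by
  induction h with
  | refl => exact Relation.ReflTransGen.refl
  | tail _ h ih =>
    obtain ⟨x, hx, rfl⟩ := h
    exact ih.tail ⟨x.rev, by simpa using hx, (topple_rev x _).symm⟩

/-- The mirror image of a stable configuration. -/
def reflect (η : Stable N) : Stable N := ⟨η.1 ∘ Fin.rev, fun x => η.2 x.rev⟩

@[simp]
theorem reflect_reflect (η : Stable N) : reflect (reflect η) = η := by
  apply Subtype.ext
  ext i
  simp [reflect]

theorem measurable_reflect : Measurable (reflect : Stable N → Stable N) := by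
  refine Measurable.subtype_mk (measurable_pi_lambda _ fun i => ?_)
  exact (measurable_pi_apply i.rev).comp measurable_subtype_coe

theorem single_comp_rev (x : Fin N) (u : ℝ) :
    (Pi.single x u : Fin N → ℝ) ∘ Fin.rev = Pi.single x.rev u := by
  ext i
  obtain ⟨j, rfl⟩ := Fin.rev_surjective i
  by_cases h : j = x
  · subst h
    simp
  · have h' : j.rev ≠ x.rev := fun h' => h (Fin.rev_injective h')
    simp [h, h']

/-- `stabilize` sweeps from left to right and is not symmetric by definition; but the mirrored
topplings are another legal order, with the same result. -/
theorem step_reflect (η : Stable N) (x : Fin N) {u : ℝ} (h0 : 0 ≤ u) (h1 : u ≤ 1) :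
    step (reflect η) x.rev u = reflect (step η x u) := by
  have hlt : ∀ (η : Stable N) (x : Fin N), η.1 x + u < 2 := fun η x => by linarith [(η.2 x).2]
  apply Subtype.ext
  rw [step_val _ _ h0]
  refine (good_add (reflect η).2 _ h0 (hlt _ _)).stabilize_eq ?_ (reflect (step η x u)).2
  have h := reaches_rev (reaches_stabilize (η.1 + Pi.single x u))
  rw [Pi.add_comp, single_comp_rev, ← step_val η x h0] at h
  exact h

theorem reflect_mem_emptyFirst {η : Stable N} : reflect η ∈ emptyFirst N ↔ η ∈ emptyLast N := by
  unfold emptyFirst emptyLast reflect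
  simp only [Set.mem_ofPred_eq, Function.comp_apply]
  rw [← Fin.revPerm.forall_congr_right]
  refine forall_congr' fun i => ?_
  have := i.2
  have e : (i.rev : ℕ) = 0 ↔ (i : ℕ) + 1 = N := by
    rw [Fin.val_rev]
    omega
  simp only [ne_eq, Fin.revPerm_apply, Fin.rev_rev, e]

theorem reflect_mem_emptyLast {η : Stable N} : reflect η ∈ emptyLast N ↔ η ∈ emptyFirst N := by
  rw [← reflect_mem_emptyFirst, reflect_reflect]

theorem measurableSet_emptyFirst : MeasurableSet (emptyFirst N) := by
  have : emptyFirst N = ⋂ i : Fin N, {η : Stable N |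
      ((i : ℕ) = 0 → η.1 i = 0) ∧ ((i : ℕ) ≠ 0 → 1 / 2 ≤ η.1 i)} := by
    ext η
    simp [emptyFirst]
  rw [this]
  refine MeasurableSet.iInter fun i => ?_
  have hm : Measurable fun η : Stable N => η.1 i :=
    (measurable_pi_apply i).comp measurable_subtype_coe
  by_cases hi : (i : ℕ) = 0
  · simp only [hi, forall_const, ne_eq, not_true_eq_false, false_imp_iff, and_true]
    exact hm (measurableSet_singleton 0)
  · simp only [hi, false_imp_iff, ne_eq, not_false_eq_true, forall_const, true_and]
    exact measurableSet_le measurable_const hm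

/-! ### Sites with height zero or at least one half -/

/-- A toppling empties its own site and gives each neighbour at least 1/2. -/
theorem reaches_nonneg_and_regular {η ξ : Fin N → ℝ} (h : Relation.ReflTransGen TopplesTo η ξ)
    (h0 : ∀ y, 0 ≤ η y) {i : Fin N} (hi : η i = 0 ∨ 1 / 2 ≤ η i) :
    (∀ y, 0 ≤ ξ y) ∧ (ξ i = 0 ∨ 1 / 2 ≤ ξ i) := by
  induction h with
  | refl => exact ⟨h0, hi⟩
  | tail _ h ih =>
    obtain ⟨x, hx, rfl⟩ := h
    refine ⟨topple_nonneg x ih.1, ?_⟩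
    by_cases hix : i = x
    · subst hix
      exact Or.inl (topple_self hx)
    · by_cases ha : Adj x i
      · rw [topple_adj hx ha]
        exact Or.inr (by linarith [ih.1 i])
      · rw [topple_far hix ha]
        exact ih.2

theorem step_regular (η : Stable N) (x : Fin N) {u : ℝ} (hu : 1 / 2 ≤ u) {i : Fin N}
    (hi : i = x ∨ η.1 i = 0 ∨ 1 / 2 ≤ η.1 i) :
    (step η x u).1 i = 0 ∨ 1 / 2 ≤ (step η x u).1 i := by
  rw [step_val η x (by linarith)]
  refine (reaches_nonneg_and_regular (reaches_stabilize _) (fun y => ?_) ?_).2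
  · have := (η.2 y).1
    by_cases hy : y = x
    · subst hy
      simp only [Pi.add_apply, Pi.single_eq_same]
      linarith
    · simpa [hy] using this
  · by_cases hx : i = x
    · subst hx
      have := (η.2 i).1
      simp only [Pi.add_apply, Pi.single_eq_same]
      exact Or.inr (by linarith)
    · simpa [hx] using hi.resolve_left hx

end Dynamics

/-! ### Lower bounds for transition probabilities, and hitting times -/

section Transitions

variable {N : ℕ} {a b : ℝ}

theorem lintegral_uniformOn_univ (g : Fin N → ℝ≥0∞) :
    ∫⁻ x, g x ∂(uniformOn (Set.univ : Set (Fin N))) = (N : ℝ≥0∞)⁻¹ * ∑ x, g x := by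
  unfold uniformOn ProbabilityTheory.cond
  rw [lintegral_smul_measure, Measure.restrict_univ, lintegral_count, tsum_fintype,
    Measure.count_apply_finite _ Set.finite_univ]
  simp

theorem avg_kernel {f : Stable N → ℝ≥0∞} (hf : Measurable f) (η : Stable N) :
    avg (kernel N a b) f η = (N : ℝ≥0∞)⁻¹ *
      ∑ x, (ENNReal.ofReal (b - a))⁻¹ * ∫⁻ u in Set.Icc a b, f (step η x u) := by
  have hm : Measurable fun p : Fin N × ℝ => step η p.1 p.2 :=
    measurable_step.comp (measurable_prodMk_left (x := η))
  change ∫⁻ ξ, f ξ ∂((additionLaw N a b).map fun p => step η p.1 p.2) = _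
  rw [lintegral_map hf hm]
  unfold additionLaw
  have hm' : AEMeasurable (fun p : Fin N × ℝ => f (step η p.1 p.2))
      ((uniformOn (Set.univ : Set (Fin N))).prod (volume[|Set.Icc a b])) :=
    (hf.comp hm).aemeasurable
  rw [lintegral_prod _ hm', lintegral_uniformOn_univ]
  congr 1
  refine Finset.sum_congr rfl fun x _ => ?_
  unfold ProbabilityTheory.cond
  rw [lintegral_smul_measure, Real.volume_Icc, smul_eq_mul]

/-- The density of the law of one addition. -/
noncomputable def rate (N : ℕ) (a b : ℝ) : ℝ≥0∞ := (N : ℝ≥0∞)⁻¹ * (ENNReal.ofReal (b - a))⁻¹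

theorem rate_ne_zero : rate N a b ≠ 0 := by
  simp [rate]

theorem rate_mul_le_avg {f : Stable N → ℝ≥0∞} (hf : Measurable f) (η : Stable N) (x : Fin N)
    {S : Set ℝ} (hS : S ⊆ Set.Icc a b) :
    rate N a b * ∫⁻ u in S, f (step η x u) ≤ avg (kernel N a b) f η := by
  rw [avg_kernel hf, rate, mul_assoc]
  gcongr
  refine le_trans ?_ (Finset.single_le_sum (f := fun x => (ENNReal.ofReal (b - a))⁻¹ *
    ∫⁻ u in Set.Icc a b, f (step η x u)) (fun _ _ => zero_le) (Finset.mem_univ x))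
  gcongr

theorem isMarkovKernel_kernel (hN : 0 < N) (hab : a < b) : IsMarkovKernel (kernel N a b) := by
  have : Nonempty (Fin N) := ⟨⟨0, hN⟩⟩
  have h1 : IsProbabilityMeasure (uniformOn (Set.univ : Set (Fin N))) :=
    isProbabilityMeasure_uniformOn Set.finite_univ Set.univ_nonempty
  have h2 : IsProbabilityMeasure (volume[|Set.Icc a b]) :=
    cond_isProbabilityMeasure_of_finite (by simp [hab]) (by simp)
  have h3 : IsProbabilityMeasure (additionLaw N a b) := by
    unfold additionLaw
    infer_instance
  refine ⟨fun η => ?_⟩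
  exact Measure.isProbabilityMeasure_map
    (measurable_step.comp (measurable_prodMk_left (x := η))).aemeasurable

theorem avg_comp_reflect (ha : 0 ≤ a) (hb : b ≤ 1) {f : Stable N → ℝ≥0∞} (hf : Measurable f) :
    avg (kernel N a b) (f ∘ reflect) = avg (kernel N a b) f ∘ reflect := by
  ext η
  rw [avg_kernel (hf.comp measurable_reflect), Function.comp_apply, avg_kernel hf]
  congr 1
  rw [← Equiv.sum_comp Fin.revPerm]
  refine Finset.sum_congr rfl fun x _ => ?_
  congr 1
  refine setLIntegral_congr_fun measurableSet_Icc fun u hu => ?_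
  obtain ⟨y, rfl⟩ := Fin.rev_surjective x
  have := step_reflect η y.rev.rev (ha.trans hu.1) (hu.2.trans hb)
  simp only [Function.comp_apply, Fin.revPerm_apply]
  rw [← this, Fin.rev_rev]

theorem avg_iterate_comp_reflect (ha : 0 ≤ a) (hb : b ≤ 1) {f : Stable N → ℝ≥0∞}
    (hf : Measurable f) (n : ℕ) :
    (avg (kernel N a b))^[n] (f ∘ reflect) = (avg (kernel N a b))^[n] f ∘ reflect := by
  induction n with
  | zero => rfl
  | succ n ih =>
    rw [Function.iterate_succ_apply', ih, avg_comp_reflect ha hb (measurable_avg_iterate hf n),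
      Function.iterate_succ_apply']

/-- The configurations from which suitable additions, at one site and from an interval of length
`ε`, lead to `S`. -/
def pre (a b ε : ℝ) (S : Set (Stable N)) : Set (Stable N) :=
  {η | ∃ (x : Fin N) (l : ℝ), a ≤ l ∧ l + ε ≤ b ∧ ∀ u ∈ Set.Icc l (l + ε), step η x u ∈ S}

theorem pre_mono {ε : ℝ} : Monotone (pre a b ε : Set (Stable N) → Set (Stable N)) := by
  rintro S T h η ⟨x, l, h1, h2, h3⟩
  exact ⟨x, l, h1, h2, fun u hu => h (h3 u hu)⟩

theorem mul_le_avg_of_mem_pre {ε : ℝ} {S : Set (Stable N)} {g : Stable N → ℝ≥0∞}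
    (hg : Measurable g) {p : ℝ≥0∞} (hp : ∀ ξ ∈ S, p ≤ g ξ) {η : Stable N} (hη : η ∈ pre a b ε S) :
    rate N a b * ENNReal.ofReal ε * p ≤ avg (kernel N a b) g η := by
  obtain ⟨x, l, h1, h2, h3⟩ := hη
  refine le_trans ?_ (rate_mul_le_avg hg η x (Set.Icc_subset_Icc h1 h2))
  rw [mul_assoc]
  gcongr
  calc ENNReal.ofReal ε * p = ∫⁻ _ in Set.Icc l (l + ε), p := by
        rw [setLIntegral_const, Real.volume_Icc, add_sub_cancel_left, mul_comm]
    _ ≤ _ := setLIntegral_mono' measurableSet_Icc fun u hu => hp _ (h3 u hu)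

theorem pow_mul_le_avg_iterate {ε : ℝ} {S : Set (Stable N)} {g : Stable N → ℝ≥0∞}
    (hg : Measurable g) {p : ℝ≥0∞} (hp : ∀ ξ ∈ S, p ≤ g ξ) (k : ℕ) {η : Stable N}
    (hη : η ∈ (pre a b ε)^[k] S) :
    (rate N a b * ENNReal.ofReal ε) ^ k * p ≤ (avg (kernel N a b))^[k] g η := by
  induction k generalizing η with
  | zero => simpa using hp η hη
  | succ k ih =>
    rw [Function.iterate_succ_apply'] at hη ⊢
    rw [pow_succ', mul_assoc]
    exact mul_le_avg_of_mem_pre (measurable_avg_iterate hg k) (fun ξ hξ => ih hξ) hη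

/-- The configurations from which suitable additions lead to `E` within `k` steps. -/
def within (a b ε : ℝ) (E : Set (Stable N)) (k : ℕ) : Set (Stable N) :=
  (fun S => E ∪ pre a b ε S)^[k] E

theorem within_succ (ε : ℝ) (E : Set (Stable N)) (k : ℕ) :
    within a b ε E (k + 1) = E ∪ pre a b ε (within a b ε E k) :=
  Function.iterate_succ_apply' _ _ _

theorem subset_within (ε : ℝ) (E : Set (Stable N)) (k : ℕ) : E ⊆ within a b ε E k := by
  cases k with
  | zero => exact subset_rfl
  | succ k =>
    rw [within_succ]
    exact Set.subset_union_left

theorem within_mono (ε : ℝ) (E : Set (Stable N)) : Monotone (within a b ε E) := by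
  refine monotone_nat_of_le_succ fun k => ?_
  induction k with
  | zero => exact subset_within ε E 1
  | succ k ih =>
    rw [within_succ, within_succ]
    exact Set.union_subset_union_right _ (pre_mono ih)

/-- The minimum with 1 keeps the bound from increasing with `k`, so that it also covers
configurations already in `E`. -/
theorem pow_le_sum_of_mem_within {ε : ℝ} {E : Set (Stable N)} (hE : MeasurableSet E) (k : ℕ)
    {η : Stable N} (hη : η ∈ within a b ε E k) :
    (min 1 (rate N a b * ENNReal.ofReal ε)) ^ k ≤
      ∑ t ∈ Finset.range (k + 1), (avg (kernel N a b))^[t] (E.indicator 1) η := by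
  have hm : Measurable (E.indicator (1 : Stable N → ℝ≥0∞)) := measurable_one.indicator hE
  have h0 : ∀ (k : ℕ) (η : Stable N), η ∈ E →
      (min 1 (rate N a b * ENNReal.ofReal ε)) ^ k ≤
      ∑ t ∈ Finset.range (k + 1), (avg (kernel N a b))^[t] (E.indicator 1) η := by
    intro k η hη
    refine (pow_le_one₀ zero_le (min_le_left _ _)).trans ?_
    refine le_trans ?_ (Finset.single_le_sum (fun _ _ => zero_le)
      (Finset.mem_range.2 (Nat.succ_pos k)))
    simp [hη]
  induction k generalizing η with
  | zero => exact h0 0 η hη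
  | succ k ih =>
    rw [within_succ] at hη
    rcases hη with hη | hη
    · exact h0 _ η hη
    · have hg : Measurable (∑ t ∈ Finset.range (k + 1),
          (avg (kernel N a b))^[t] (E.indicator (1 : Stable N → ℝ≥0∞))) :=
        by simpa only [Finset.sum_fn] using
          Finset.measurable_fun_sum _ fun t _ => measurable_avg_iterate hm t
      have := mul_le_avg_of_mem_pre hg (p := (min 1 (rate N a b * ENNReal.ofReal ε)) ^ k)
        (fun ξ hξ => by simpa using ih hξ) hη
      rw [Finset.sum_range_succ', pow_succ']
      refine le_trans ?_ le_self_add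
      refine le_trans (mul_le_mul_left (min_le_right _ _) _) (this.trans_eq ?_)
      have e := congrFun (avg_iterate_sum (P := kernel N a b) (Finset.range (k + 1))
        (fun t => measurable_avg_iterate (P := kernel N a b) hm t) 1) η
      rw [Function.iterate_one] at e
      rw [e, Finset.sum_apply]
      refine Finset.sum_congr rfl fun t _ => ?_
      rw [← Function.iterate_succ_apply' (avg (kernel N a b))]

/-- As long as the site stays below 1, no addition topples anything and only the total `s` matters.
-/
theorem mem_pre_iterate_of_add (ha : 0 ≤ a) {l ε : ℝ} (hl : a ≤ l) (hε : 0 ≤ ε) (hlb : l + ε ≤ b)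
    (x : Fin N) {T : Set (Stable N)} (k : ℕ) {η : Stable N} (hk : η.1 x + k * (l + ε) < 1)
    (hT : ∀ s ∈ Set.Icc (k * l) (k * (l + ε)), ∀ ξ : Stable N,
      ξ.1 = η.1 + Pi.single x s → ξ ∈ T) : η ∈ (pre a b ε)^[k] T := by
  induction k generalizing η with
  | zero => exact hT 0 (by simp) η (by simp)
  | succ k ih =>
    rw [Function.iterate_succ_apply']
    refine ⟨x, l, hl, hlb, fun u hu => ?_⟩
    have hu0 : 0 ≤ u := (ha.trans hl).trans hu.1
    have hk0 : 0 ≤ (k : ℝ) * (l + ε) := mul_nonneg (Nat.cast_nonneg k) (by linarith)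
    push_cast at hk
    have hv := step_of_lt_one η x hu0 (by linarith [hu.2])
    refine ih ?_ fun s hs ξ hξ => hT (u + s) ?_ ξ ?_
    · rw [hv]
      simp only [Pi.add_apply, Pi.single_eq_same]
      linarith [hu.2]
    · push_cast
      constructor <;> linarith [hs.1, hs.2, hu.1, hu.2]
    · rw [hξ, hv, add_assoc, ← Pi.single_add]

/-! ### Hitting a configuration whose only empty site is the last one -/

theorem sum_add_single (η : Fin N → ℝ) (x : Fin N) (u : ℝ) :
    ∑ i, (η + Pi.single x u : Fin N → ℝ) i = ∑ i, η i + u := by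
  simp [Finset.sum_add_distrib]

theorem sum_lt_of_stable (hN : 0 < N) (η : Stable N) : ∑ i, η.1 i < N := by
  have : Nonempty (Fin N) := ⟨⟨0, hN⟩⟩
  calc ∑ i, η.1 i < ∑ _ : Fin N, (1 : ℝ) :=
        Finset.sum_lt_sum_of_nonempty Finset.univ_nonempty fun i _ => (η.2 i).2
    _ = N := by simp

theorem exists_le_mul_sum {d : ℝ} (hd : 0 < d) :
    ∃ k : ℕ, ∀ η : Stable N, (N : ℝ) - k * d ≤ ∑ i, η.1 i := by
  obtain ⟨k, hk⟩ := exists_nat_ge ((N : ℝ) / d)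
  refine ⟨k, fun η => ?_⟩
  rw [div_le_iff₀ hd] at hk
  have : 0 ≤ ∑ i, η.1 i := Finset.sum_nonneg fun i _ => (η.2 i).1
  linarith

/-- Site 0 receives amounts in [c - w, c] while these cannot topple it; once every amount in [c, c +
w] must topple it, such an amount starts a sweep. Each filling step raises the total mass, which
stays below `N`, by at least c - w, so their number is bounded. -/
theorem exists_within_of_full (hN : 0 < N) (hb : b ≤ 1) {c w : ℝ} (hw : 0 < w)
    (h1 : a ≤ c - w) (h2 : c + w ≤ b) (h3 : 0 < c - w) :
    ∃ k, ∀ η : Stable N, (∀ i, 1 / 2 ≤ η.1 i) → η ∈ within a b w (emptyLast N) k := by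
  obtain ⟨k, hk⟩ := exists_le_mul_sum (N := N) h3
  refine ⟨k, fun η hη => ?_⟩
  have key : ∀ (k : ℕ) (η : Stable N), (∀ i, 1 / 2 ≤ η.1 i) →
      (N : ℝ) - k * (c - w) ≤ ∑ i, η.1 i → η ∈ within a b w (emptyLast N) k := by
    intro k
    induction k with
    | zero =>
      intro η _ hs
      have := sum_lt_of_stable hN η
      simp only [Nat.cast_zero, zero_mul, sub_zero] at hs
      linarith
    | succ k ih =>
      intro η hη hs
      rw [within_succ]
      right
      by_cases hc : 1 ≤ η.1 ⟨0, hN⟩ + c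
      · refine ⟨⟨0, hN⟩, c, by linarith, h2, fun u hu => subset_within _ _ _ ?_⟩
        have h0 := (η.2 ⟨0, hN⟩).2
        have e : coord 0 (η.1 + Pi.single ⟨0, hN⟩ u) = η.1 ⟨0, hN⟩ + u := by
          rw [coord_apply ⟨0, hN⟩]
          simp
        have hne : ∀ i : Fin N, 0 < (i : ℕ) → (η.1 + Pi.single ⟨0, hN⟩ u : Fin N → ℝ) i = η.1 i := by
          intro i hi
          have : i ≠ ⟨0, hN⟩ := by
            rintro rfl
            simp at hi
          simp [this]
        refine step_sweep_mem η ⟨0, hN⟩ (by linarith [hu.1]) (p := 0) rfl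
          ⟨hN, Or.inl rfl, ?_, ?_, fun i hi => ?_, fun i hi => ?_⟩
        · rw [e]
          linarith [hu.1]
        · rw [e]
          linarith [hu.2]
        · rw [hne i hi]
          exact hη i
        · rw [hne i hi]
          exact (η.2 i).2
      · push Not at hc
        refine ⟨⟨0, hN⟩, c - w, h1, by linarith, fun u hu => ?_⟩
        have hv := step_of_lt_one η ⟨0, hN⟩ (u := u) (by linarith [hu.1]) (by linarith [hu.2])
        refine ih _ (fun i => ?_) ?_
        · rw [hv]
          have : (0 : ℝ) ≤ (Pi.single ⟨0, hN⟩ u : Fin N → ℝ) i := by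
            by_cases h : i = ⟨0, hN⟩
            · subst h
              simp only [Pi.single_eq_same]
              linarith [hu.1]
            · simp [h]
          simp only [Pi.add_apply]
          linarith [hη i]
        · rw [hv, sum_add_single]
          push_cast at hs
          linarith [hu.1]
  exact key k η hη (hk η)

/-- In a class `S` where sites below 1/2 can be filled without toppling, the same mass count bounds
the time until all sites are full. -/
theorem exists_within_of_fillable (hN : 0 < N) (hb : b ≤ 1) {c w : ℝ} (hw : 0 < w)
    (h1 : a ≤ c - w) (h2 : c + w ≤ b) (h3 : 0 < c - w) (S : Set (Stable N))
    (hS : ∀ η ∈ S, ∀ x, η.1 x < 1 / 2 → ∀ u ∈ Set.Icc (c - w) c,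
      η.1 x + u < 1 ∧ step η x u ∈ S) :
    ∃ k, ∀ η ∈ S, η ∈ within a b w (emptyLast N) k := by
  obtain ⟨k₀, hk₀⟩ := exists_within_of_full hN hb hw h1 h2 h3
  obtain ⟨k, hk⟩ := exists_le_mul_sum (N := N) h3
  refine ⟨k₀ + k, fun η hη => ?_⟩
  have key : ∀ (k : ℕ), ∀ η ∈ S,
      (N : ℝ) - k * (c - w) ≤ ∑ i, η.1 i → η ∈ within a b w (emptyLast N) (k₀ + k) := by
    intro k
    induction k with
    | zero =>
      intro η _ hs
      have := sum_lt_of_stable hN η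
      simp only [Nat.cast_zero, zero_mul, sub_zero] at hs
      linarith
    | succ k ih =>
      intro η hη hs
      by_cases hf : ∀ i, 1 / 2 ≤ η.1 i
      · exact within_mono _ _ (Nat.le_add_right _ _) (hk₀ η hf)
      · push Not at hf
        obtain ⟨x, hx⟩ := hf
        rw [← add_assoc, within_succ]
        refine Or.inr ⟨x, c - w, h1, by linarith, fun u hu => ?_⟩
        rw [sub_add_cancel] at hu
        obtain ⟨h4, h5⟩ := hS η hη x hx u hu
        refine ih _ h5 ?_
        rw [step_of_lt_one η x (by linarith [hu.1]) h4, sum_add_single]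
        push_cast at hs
        linarith [hu.1]
  exact key k η hη (hk η)

/-- For c < 1/2, an addition to a site below 1/2 never topples it. For amounts of at least 1/2 this
can fail, but then the heights can first be brought into {0} ∪ [1/2, 1), where a site below 1/2 is
empty. -/
theorem exists_within (hN : 0 < N) (hb : b ≤ 1) {c w : ℝ} (hw : 0 < w)
    (h1 : a ≤ c - w) (h2 : c + w ≤ b) (h3 : 0 < c - w) (hc : c < 1 / 2 ∨ 1 / 2 ≤ c - w) :
    ∃ k, ∀ η : Stable N, η ∈ within a b w (emptyLast N) k := by
  rcases hc with hc | hc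
  · obtain ⟨k, hk⟩ := exists_within_of_fillable hN hb hw h1 h2 h3 Set.univ
      fun η _ x hx u hu => ⟨by linarith [hu.2], trivial⟩
    exact ⟨k, fun η => hk η trivial⟩
  · obtain ⟨k, hk⟩ := exists_within_of_fillable hN hb hw h1 h2 h3
      {η | ∀ i, η.1 i = 0 ∨ 1 / 2 ≤ η.1 i} fun η hη x hx u hu =>
        ⟨by
          rcases hη x with h | h
          · rw [h]
            linarith [hu.2]
          · linarith, fun i => step_regular η x (by linarith [hu.1]) (Or.inr (hη i))⟩
    -- One addition at each site in turn makes all heights zero or at least 1/2: the addition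
    -- regularizes its own site, and topplings preserve regular sites.
    have key : ∀ d p : ℕ, p + d = N → ∀ η : Stable N,
        (∀ i : Fin N, (i : ℕ) < p → η.1 i = 0 ∨ 1 / 2 ≤ η.1 i) →
        η ∈ within a b w (emptyLast N) (k + d) := by
      intro d
      induction d with
      | zero =>
        intro p hp η hη
        exact hk η fun i => hη i (by have := i.2; omega)
      | succ d ih =>
        intro p hp η hη
        rw [← add_assoc, within_succ]
        refine Or.inr ⟨⟨p, by omega⟩, c - w, h1, by linarith, fun u hu => ?_⟩
        refine ih (p + 1) (by omega) _ fun i hi => step_regular η _ (by linarith [hu.1]) ?_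
        by_cases h : (i : ℕ) = p
        · exact Or.inl (Fin.ext h)
        · exact Or.inr (hη i (by omega))
    exact ⟨k + N, fun η => key N 0 (by omega) η fun i hi => absurd hi (Nat.not_lt_zero _)⟩

theorem measurableSet_emptyLast : MeasurableSet (emptyLast N) := by
  have : emptyLast N = reflect ⁻¹' emptyFirst N := by
    ext η
    exact reflect_mem_emptyFirst.symm
  rw [this]
  exact measurable_reflect measurableSet_emptyFirst

theorem indicator_emptyFirst :
    (emptyFirst N).indicator (1 : Stable N → ℝ≥0∞) = (emptyLast N).indicator 1 ∘ reflect := by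
  ext η
  by_cases h : η ∈ emptyFirst N
  · simp [h, reflect_mem_emptyLast]
  · simp [h, reflect_mem_emptyLast]

theorem exists_le_sum_emptyFirst (hN : 0 < N) (ha : 0 ≤ a) (hb : b ≤ 1) {c w : ℝ} (hw : 0 < w)
    (h1 : a ≤ c - w) (h2 : c + w ≤ b) (h3 : 0 < c - w) (hc : c < 1 / 2 ∨ 1 / 2 ≤ c - w) :
    ∃ T, ∃ q : ℝ≥0∞, q ≠ 0 ∧ ∀ η : Stable N,
      q ≤ ∑ t ∈ Finset.range T, (avg (kernel N a b))^[t] ((emptyFirst N).indicator 1) η := by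
  obtain ⟨k, hk⟩ := exists_within hN hb hw h1 h2 h3 hc
  refine ⟨k + 1, (min 1 (rate N a b * ENNReal.ofReal w)) ^ k, ?_, fun η => ?_⟩
  · refine pow_ne_zero _ ?_
    have h : 0 < rate N a b * ENNReal.ofReal w :=
      ENNReal.mul_pos rate_ne_zero (by simpa using hw)
    exact (lt_min one_pos h).ne'
  · have hm : Measurable ((emptyLast N).indicator (1 : Stable N → ℝ≥0∞)) :=
      measurable_one.indicator measurableSet_emptyLast
    rw [indicator_emptyFirst]
    simp only [avg_iterate_comp_reflect ha hb hm]
    exact pow_le_sum_of_mem_within measurableSet_emptyLast k (hk (reflect η))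

end Transitions

/-! ### The linear map of a sweep: contraction and controllability -/

section Zigzag

variable {N : ℕ}

/-- The unit vector at site `k`; zero outside the line. -/
def unitVec (k : ℕ) (i : Fin N) : ℝ := if (i : ℕ) = k then 1 else 0

/-- The sweep of the line from left to right, followed by a reflection, as a linear map. -/
noncomputable def zig : (Fin N → ℝ) →ₗ[ℝ] (Fin N → ℝ) :=
  LinearMap.pi fun i => if 0 < (i : ℕ) then (1 / 2 : ℝ) • acc (N - i) else 0

theorem zig_apply (w : Fin N → ℝ) (i : Fin N) :
    zig w i = if 0 < (i : ℕ) then acc (N - i) w / 2 else 0 := by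
  unfold zig
  rw [LinearMap.pi_apply]
  split_ifs
  · simp only [LinearMap.smul_apply, smul_eq_mul]
    ring
  · rfl

theorem afterSweep_comp_rev (w : Fin N → ℝ) : afterSweep w ∘ Fin.rev = zig w := by
  ext i
  have := i.2
  rw [zig_apply, Function.comp_apply, afterSweep, Fin.val_rev]
  by_cases h : 0 < (i : ℕ)
  · rw [if_pos h, if_pos (by omega), show N - ((i : ℕ) + 1) + 1 = N - i by omega]
  · rw [if_neg h, if_neg (by omega)]

theorem coord_zero_zig (w : Fin N → ℝ) : coord 0 (zig w) = 0 := by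
  by_cases h : 0 < N
  · rw [coord_apply ⟨0, h⟩, zig_apply]
    simp
  · simp [coord, h]

theorem coord_zero_zig_pow {k : ℕ} {d : Fin N → ℝ} (hd : coord 0 d = 0) :
    coord 0 ((zig ^ k) d) = 0 := by
  cases k with
  | zero => simpa using hd
  | succ k =>
    rw [pow_succ', Module.End.mul_apply]
    exact coord_zero_zig _

theorem abs_coord_le {w : Fin N → ℝ} {B : ℝ} (h0 : 0 ≤ B) (h : ∀ i, |w i| ≤ B) (k : ℕ) :
    |coord k w| ≤ B := by
  unfold coord
  split_ifs with hk
  · exact h ⟨k, hk⟩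
  · simpa using h0

/-- Nothing arrives from site 0, so the toppling heights are at most B + B/2 + B/4 + ... with only
finitely many terms, which stays strictly below 2B. -/
theorem abs_zig_le_of_coord_zero {w : Fin N → ℝ} {B : ℝ} (h : ∀ i, |w i| ≤ B)
    (hw : coord 0 w = 0) (i : Fin N) : |zig w i| ≤ (1 - (1 / 2) ^ N) * B := by
  have h0 : 0 ≤ B := (abs_nonneg _).trans (h i)
  have key : ∀ k, |acc k w| ≤ 2 * (1 - (1 / 2) ^ k) * B := by
    intro k
    induction k with
    | zero => simp [acc_zero, hw]
    | succ k ih =>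
      rw [acc_succ]
      have h1 := abs_add_le (coord (k + 1) w) (acc k w / 2)
      have h2 := abs_coord_le h0 h (k + 1)
      rw [abs_div, abs_two] at h1
      rw [pow_succ]
      linarith
  have hN : (0 : ℝ) ≤ 1 - (1 / 2) ^ N := by
    have : ((1 : ℝ) / 2) ^ N ≤ 1 := pow_le_one₀ (by norm_num) (by norm_num)
    linarith
  rw [zig_apply]
  split_ifs with hi
  · have h1 := key (N - i)
    have h2 : ((1 : ℝ) / 2) ^ N ≤ (1 / 2) ^ (N - (i : ℕ)) :=
      pow_le_pow_of_le_one (by norm_num) (by norm_num) (Nat.sub_le _ _)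
    have h3 : (1 - ((1 : ℝ) / 2) ^ (N - (i : ℕ))) * B ≤ (1 - (1 / 2) ^ N) * B := by
      gcongr
    rw [abs_div, abs_two]
    linarith
  · simpa using mul_nonneg hN h0

/-- The bound 2B on toppling heights reproduces itself, as B + 2B/2 = 2B; hence the weaker
requirement at site 0. -/
theorem abs_zig_le {w : Fin N → ℝ} {B : ℝ} (h0 : |coord 0 w| ≤ 2 * B)
    (h : ∀ i : Fin N, 0 < (i : ℕ) → |w i| ≤ B) (i : Fin N) : |zig w i| ≤ B := by
  have hB : 0 ≤ B := by linarith [abs_nonneg (coord 0 w)]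
  have key : ∀ k, |acc k w| ≤ 2 * B := by
    intro k
    induction k with
    | zero => exact h0
    | succ k ih =>
      rw [acc_succ]
      have h1 := abs_add_le (coord (k + 1) w) (acc k w / 2)
      have h2 : |coord (k + 1) w| ≤ B := by
        unfold coord
        split_ifs with hk
        · exact h ⟨k + 1, hk⟩ (Nat.succ_pos k)
        · simpa using hB
      rw [abs_div, abs_two] at h1
      linarith
  rw [zig_apply]
  split_ifs with hi
  · have h1 := key (N - i)
    rw [abs_div, abs_two]
    linarith
  · simpa using hB

theorem abs_zig_pow_le {w : Fin N → ℝ} {B : ℝ} (h : ∀ i, |w i| ≤ B) (hw : coord 0 w = 0) (k : ℕ)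
    (i : Fin N) : |(zig ^ k) w i| ≤ (1 - (1 / 2) ^ N) ^ k * B := by
  induction k generalizing i with
  | zero => simpa using h i
  | succ k ih =>
    rw [pow_succ', Module.End.mul_apply, pow_succ', mul_assoc]
    exact abs_zig_le_of_coord_zero ih (coord_zero_zig_pow hw) i

/-! ### Controllability -/

theorem coord_unitVec {k m : ℕ} (hm : m < N) :
    coord m (unitVec k : Fin N → ℝ) = if m = k then 1 else 0 := by
  rw [coord_apply ⟨m, hm⟩]
  rfl

/-- The half passed on by site k is cancelled at site k + 1. These vectors are thus dual to the
functionals `acc m`, and `zig` maps them to multiples of unit vectors. -/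
theorem acc_unitVec_sub {k m : ℕ} (hm : m < N) :
    acc m (unitVec k - (1 / 2 : ℝ) • unitVec (k + 1) : Fin N → ℝ) = if m = k then 1 else 0 := by
  induction m with
  | zero =>
    rw [acc_zero, map_sub, map_smul, coord_unitVec hm, coord_unitVec hm]
    simp
  | succ m ih =>
    rw [acc_succ, ih (by omega), map_sub, map_smul, coord_unitVec hm, coord_unitVec hm]
    by_cases h1 : m = k
    · subst h1
      simp
    · by_cases h2 : m + 1 = k
      · simp [h1, h2]
      · simp [h1, h2]

theorem zig_unitVec_sub {k : ℕ} (hkN : k < N) :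
    zig (unitVec k - (1 / 2 : ℝ) • unitVec (k + 1) : Fin N → ℝ) =
      (1 / 2 : ℝ) • unitVec (N - k) := by
  ext i
  have := i.2
  rw [zig_apply]
  simp only [Pi.smul_apply, unitVec, smul_eq_mul]
  by_cases hi : 0 < (i : ℕ)
  · rw [if_pos hi, acc_unitVec_sub (by omega)]
    by_cases h : (i : ℕ) = N - k
    · rw [if_pos h, if_pos (by omega)]
      norm_num
    · rw [if_neg h, if_neg (by omega)]
      norm_num
  · rw [if_neg hi, if_neg (by omega)]
    norm_num

theorem zig_unitVec_zero :
    zig (unitVec 0 : Fin N → ℝ) = zig ((1 / 2 : ℝ) • unitVec 1 : Fin N → ℝ) := by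
  rw [← sub_eq_zero, ← map_sub]
  ext i
  have := i.2
  rw [zig_apply]
  by_cases hi : 0 < (i : ℕ)
  · rw [if_pos hi, acc_unitVec_sub (by omega), if_neg (by omega)]
    simp
  · rw [if_neg hi]
    rfl

/-- `zig y` records the toppling heights of all sites but 0, and by `acc_succ` successive toppling
heights determine the heights. -/
theorem eq_zero_of_zig_eq_zero {y : Fin N → ℝ} (h0 : coord 0 y = 0) (h : zig y = 0) : y = 0 := by
  have hacc : ∀ k, k < N → acc k y = 0 := by
    intro k hk
    rcases Nat.eq_zero_or_pos k with rfl | hk0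
    · exact h0
    · have := congrFun h ⟨N - k, by omega⟩
      rw [zig_apply, if_pos (by simp only; omega)] at this
      simp only [Pi.zero_apply] at this
      rw [show N - (N - k) = k by omega] at this
      linarith
  ext i
  rcases Nat.eq_zero_or_pos (i : ℕ) with hi | hi
  · rw [← coord_apply i y, hi, h0]
    rfl
  · obtain ⟨k, hk⟩ := Nat.exists_eq_succ_of_ne_zero hi.ne'
    have h1 := hacc i i.2
    rw [hk, Nat.succ_eq_add_one, acc_succ, hacc k (by have := i.2; omega), ← Nat.succ_eq_add_one,
      ← hk, coord_apply i] at h1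
    simpa using h1

/-- The differences that can be produced by changing the amounts added at site `0`. -/
noncomputable def reachable (N : ℕ) : Submodule ℝ (Fin N → ℝ) :=
  Submodule.span ℝ (Set.range fun k : ℕ => (zig ^ (k + 1)) (unitVec 0 : Fin N → ℝ))

theorem reachable_le : reachable N ≤ LinearMap.ker (coord 0) := by
  refine Submodule.span_le.2 ?_
  rintro _ ⟨k, rfl⟩
  rw [SetLike.mem_coe, LinearMap.mem_ker]
  simp only [pow_succ', Module.End.mul_apply]
  exact coord_zero_zig _

theorem zig_mem_reachable {y : Fin N → ℝ} (hy : y ∈ reachable N) : zig y ∈ reachable N := by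
  have : reachable N ≤ (reachable N).comap zig := by
    refine Submodule.span_le.2 ?_
    rintro _ ⟨k, rfl⟩
    refine Submodule.subset_span ⟨k + 1, ?_⟩
    simp only [pow_succ' _ (k + 1), Module.End.mul_apply]
  exact this hy

/-- On the finite-dimensional space `reachable N` the injective map `zig` is onto, so `zig y` has a
preimage there; by injectivity on vectors vanishing at site 0, that preimage is `y`. -/
theorem mem_reachable_of_zig {y : Fin N → ℝ} (h0 : coord 0 y = 0) (hy : zig y ∈ reachable N) :
    y ∈ reachable N := by
  set f : reachable N →ₗ[ℝ] reachable N := zig.restrict fun _ h => zig_mem_reachable h with hf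
  have hinj : Function.Injective f := by
    rw [← LinearMap.ker_eq_bot, LinearMap.ker_eq_bot']
    intro z hz
    apply Subtype.ext
    exact eq_zero_of_zig_eq_zero (reachable_le z.2) (congrArg Subtype.val hz)
  obtain ⟨z, hz⟩ := LinearMap.injective_iff_surjective.1 hinj ⟨zig y, hy⟩
  have hz' : zig z.1 = zig y := congrArg Subtype.val hz
  have : y = z.1 := by
    rw [← sub_eq_zero]
    refine eq_zero_of_zig_eq_zero ?_ ?_
    · rw [map_sub, h0, show coord 0 z.1 = 0 from reachable_le z.2, sub_zero]
    · rw [map_sub, hz', sub_self]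
  rw [this]
  exact z.2

theorem unitVec_sub_mem_reachable {k : ℕ} (hk : 0 < k) (hkN : k < N)
    (h : (unitVec (N - k) : Fin N → ℝ) ∈ reachable N) :
    (unitVec k - (1 / 2 : ℝ) • unitVec (k + 1) : Fin N → ℝ) ∈ reachable N := by
  refine mem_reachable_of_zig ?_ ?_
  · rw [← acc_zero, acc_unitVec_sub (by omega), if_neg (by omega)]
  · rw [zig_unitVec_sub hkN]
    exact Submodule.smul_mem _ _ h

/-- Write e_k for the unit vectors, with e_N = 0. As zig e₀ = zig (e₁/2), e₁ is reachable. As zig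
(e_k - e_{k+1}/2) = e_{N-k}/2, reachability of e_{N-k} gives that of e_k - e_{k+1}/2. Applied
alternately at k and at N - k - 1, this advances from both ends of the line at once. -/
theorem unitVec_mem_reachable {k : ℕ} (hk : 0 < k) (hkN : k < N) :
    (unitVec k : Fin N → ℝ) ∈ reachable N ∧ (unitVec (N - k) : Fin N → ℝ) ∈ reachable N := by
  induction k, hk using Nat.le_induction with
  | base =>
    have h1 : ((1 / 2 : ℝ) • unitVec 1 : Fin N → ℝ) ∈ reachable N := by
      refine mem_reachable_of_zig ?_ ?_
      · rw [map_smul, coord_unitVec (by omega)]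
        simp
      · rw [← zig_unitVec_zero]
        exact Submodule.subset_span ⟨0, by simp⟩
    have h2 : (unitVec 1 : Fin N → ℝ) ∈ reachable N := by
      have := Submodule.smul_mem _ (2 : ℝ) h1
      rwa [smul_smul, show (2 : ℝ) * (1 / 2) = 1 by norm_num, one_smul] at this
    refine ⟨h2, ?_⟩
    have h3 := unitVec_sub_mem_reachable (N := N) (k := N - 1) (by omega) (by omega)
      (by rwa [show N - (N - 1) = 1 by omega])
    have h4 : (unitVec (N - 1 + 1) : Fin N → ℝ) = 0 := by
      ext i
      have := i.2
      simp only [unitVec, Pi.zero_apply]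
      rw [if_neg (by omega)]
    rwa [h4, smul_zero, sub_zero] at h3
  | succ k hk ih =>
    obtain ⟨h1, h2⟩ := ih (by omega)
    have h3 : (unitVec (k + 1) : Fin N → ℝ) ∈ reachable N := by
      have h4 := Submodule.smul_mem _ (2 : ℝ)
        (Submodule.sub_mem _ h1 (unitVec_sub_mem_reachable (by omega) (by omega) h2))
      rwa [sub_sub_cancel, smul_smul, show (2 : ℝ) * (1 / 2) = 1 by norm_num, one_smul] at h4
    refine ⟨h3, ?_⟩
    have h5 := unitVec_sub_mem_reachable (N := N) (k := N - (k + 1)) (by omega) (by omega)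
      (by rwa [show N - (N - (k + 1)) = k + 1 by omega])
    rw [show N - (k + 1) + 1 = N - k by omega] at h5
    have := Submodule.add_mem _ h5 (Submodule.smul_mem _ (1 / 2 : ℝ) h2)
    rwa [sub_add_cancel] at this

theorem eq_sum_unitVec (y : Fin N → ℝ) : y = ∑ i : Fin N, y i • unitVec (i : ℕ) := by
  ext j
  simp [Finset.sum_apply, unitVec, Fin.val_inj]

/-- Expanding the finitely many unit vectors once makes the number of rounds and the constant K
uniform in y. -/
theorem exists_control_coeff : ∃ (n : ℕ) (K : ℝ), 0 ≤ K ∧ ∀ (y : Fin N → ℝ) (B : ℝ), 0 ≤ B →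
    coord 0 y = 0 → (∀ i, |y i| ≤ B) → ∃ γ : ℕ → ℝ, (∀ k, |γ k| ≤ K * B) ∧ (∀ k, n ≤ k → γ k = 0) ∧
      y = ∑ k ∈ Finset.range n, γ k • (zig ^ (k + 1)) (unitVec 0) := by
  have hc : ∀ i : Fin N, ∃ c : ℕ →₀ ℝ, 0 < (i : ℕ) →
      c.sum (fun k r => r • (zig ^ (k + 1)) (unitVec 0 : Fin N → ℝ)) = unitVec (i : ℕ) := by
    intro i
    by_cases hi : 0 < (i : ℕ)
    · obtain ⟨c, hc⟩ := Finsupp.mem_span_range_iff_exists_finsupp.1 (unitVec_mem_reachable hi i.2).1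
      exact ⟨c, fun _ => hc⟩
    · exact ⟨0, fun h => absurd h hi⟩
  choose c hc using hc
  set S : Finset ℕ := Finset.univ.biUnion fun i => (c i).support with hS
  set n : ℕ := S.sup id + 1 with hn
  have hlt : ∀ i k, n ≤ k → c i k = 0 := by
    intro i k hk
    by_contra h
    have h1 : k ∈ S := Finset.mem_biUnion.2 ⟨i, Finset.mem_univ i, Finsupp.mem_support_iff.2 h⟩
    have h2 : k ≤ S.sup id := Finset.le_sup (f := id) h1
    omega
  have hrange : ∀ i : Fin N, 0 < (i : ℕ) → (unitVec (i : ℕ) : Fin N → ℝ) =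
      ∑ k ∈ Finset.range n, c i k • (zig ^ (k + 1)) (unitVec 0) := by
    intro i hi
    rw [← hc i hi]
    refine Finsupp.sum_of_support_subset _ (fun k hk => ?_) _ fun k _ => zero_smul _ _
    rw [Finset.mem_range]
    by_contra h
    exact Finsupp.mem_support_iff.1 hk (hlt i k (not_lt.1 h))
  refine ⟨n, ∑ i, ∑ k ∈ Finset.range n, |c i k|, by positivity, fun y B hB hy0 hyB =>
    ⟨fun k => ∑ i, y i * c i k, fun k => ?_, fun k hk => ?_, ?_⟩⟩
  · rw [Finset.sum_mul]
    refine (Finset.abs_sum_le_sum_abs _ _).trans (Finset.sum_le_sum fun i _ => ?_)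
    rw [abs_mul, mul_comm]
    refine mul_le_mul ?_ (hyB i) (abs_nonneg _) (by positivity)
    by_cases hk : k < n
    · exact Finset.single_le_sum (f := fun k => |c i k|) (fun _ _ => abs_nonneg _)
        (Finset.mem_range.2 hk)
    · rw [hlt i k (not_lt.1 hk), abs_zero]
      positivity
  · simp [hlt _ k hk]
  · conv_lhs => rw [eq_sum_unitVec y]
    simp only [Finset.sum_smul]
    rw [Finset.sum_comm]
    refine Finset.sum_congr rfl fun i _ => ?_
    rcases Nat.eq_zero_or_pos (i : ℕ) with hi | hi
    · have : y i = 0 := by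
        rw [← coord_apply i y, hi, hy0]
      simp [this]
    · rw [hrange i hi, Finset.smul_sum]
      simp only [smul_smul]

/-- The difference `d` of two configurations can be removed in `L` rounds, by changing the amount
of each round by at most `ε`. -/
def Removable (ε : ℝ) : ℕ → (Fin N → ℝ) → Prop
  | 0, d => d = 0
  | L + 1, d => ∃ γ : ℝ, |γ| ≤ ε ∧ Removable ε L (zig (d + γ • unitVec 0))

/-- The coefficients are indexed backwards: `γ k` is the change made when `k + 1` rounds remain, so
it is hit by `zig` that many times. -/
theorem removable_of_sum {ε : ℝ} (L : ℕ) {d : Fin N → ℝ} {γ : ℕ → ℝ} (hγ : ∀ k, |γ k| ≤ ε)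
    (h : (zig ^ L) d + ∑ k ∈ Finset.range L, γ k • (zig ^ (k + 1)) (unitVec 0) = 0) :
    Removable ε L d := by
  induction L generalizing d with
  | zero => simpa [Removable] using h
  | succ L ih =>
    refine ⟨γ L, hγ L, ih ?_⟩
    rw [← h, ← Module.End.mul_apply, ← pow_succ, map_add, map_smul, Finset.sum_range_succ]
    abel

theorem exists_removable {ε : ℝ} (hε : 0 < ε) :
    ∃ L, ∀ d : Fin N → ℝ, coord 0 d = 0 → (∀ i, |d i| ≤ 1) → Removable ε (2 * L) d := by
  obtain ⟨n, K, hK, hc⟩ := exists_control_coeff (N := N)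
  have h0 : (0 : ℝ) ≤ 1 - (1 / 2) ^ N := by
    have : ((1 : ℝ) / 2) ^ N ≤ 1 := pow_le_one₀ (by norm_num) (by norm_num)
    linarith
  have h1 : (1 : ℝ) - (1 / 2) ^ N < 1 := by
    have : (0 : ℝ) < (1 / 2) ^ N := by positivity
    linarith
  obtain ⟨L₀, hL₀⟩ := exists_pow_lt_of_lt_one (show 0 < ε / (K + 1) by positivity) h1
  -- `L₀` rounds suffice to contract the difference to what corrections of size `ε` can cancel, and
  -- `n` leaves room for these corrections. The total is even so that the reflections cancel.
  refine ⟨L₀ + n, fun d hd hd1 => ?_⟩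
  set L := 2 * (L₀ + n) with hL
  obtain ⟨γ, hγ1, hγ2, hγ3⟩ := hc (-(zig ^ L) d) ((1 - (1 / 2) ^ N) ^ L) (by positivity)
    (by rw [map_neg, coord_zero_zig_pow hd, neg_zero]) (fun i => by
      have := abs_zig_pow_le hd1 hd L i
      rwa [mul_one, ← abs_neg] at this)
  refine removable_of_sum L (γ := γ) (fun k => (hγ1 k).trans ?_) ?_
  · have h2 : (1 - (1 / 2 : ℝ) ^ N) ^ L ≤ ε / (K + 1) :=
      (pow_le_pow_of_le_one h0 h1.le (by omega)).trans hL₀.le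
    calc K * (1 - (1 / 2 : ℝ) ^ N) ^ L ≤ (K + 1) * (ε / (K + 1)) := by
          gcongr
          linarith
      _ = ε := by field_simp
  · have : ∑ k ∈ Finset.range L, γ k • (zig ^ (k + 1)) (unitVec 0 : Fin N → ℝ) =
        ∑ k ∈ Finset.range n, γ k • (zig ^ (k + 1)) (unitVec 0) := by
      symm
      refine Finset.sum_subset (fun k hk => ?_) fun k _ hk => ?_
      · rw [Finset.mem_range] at *
        omega
      · rw [Finset.mem_range, not_lt] at hk
        rw [hγ2 k hk, zero_smul]
    rw [this, ← hγ3, add_neg_cancel]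

end Zigzag

/-! ### Rounds of additions and their coupling -/

section Rounds

variable {N : ℕ}

theorem sweepReady_add {p : Fin N} {η : Stable N} {g : ℝ}
    (hleft : (p : ℕ) = 0 ∨ ((p : ℕ) = 1 ∧ coord 0 η.1 = 0)) (h1 : 1 ≤ η.1 p + g)
    (h2 : η.1 p + g < 2) (hfull : ∀ i : Fin N, p < i → 1 / 2 ≤ η.1 i) :
    SweepReady (p : ℕ) (η.1 + Pi.single p g) := by
  have hne : ∀ i : Fin N, i ≠ p → (η.1 + Pi.single p g : Fin N → ℝ) i = η.1 i := by
    intro i hi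
    simp [hi]
  refine ⟨p.2, ?_, ?_, ?_, fun i hi => ?_, fun i hi => ?_⟩
  · refine hleft.imp_right fun h => ⟨h.1, ?_⟩
    have h0 : 0 < N := by have := p.2; omega
    have := h.2
    rw [coord_apply ⟨0, h0⟩] at this ⊢
    rw [hne _ (by rintro rfl; simp at h), this]
  · rw [coord_apply]
    simpa using h1
  · rw [coord_apply]
    simpa using h2
  · rw [hne i (by rintro rfl; exact lt_irrefl _ hi)]
    exact hfull i hi
  · rw [hne i (by rintro rfl; exact lt_irrefl _ hi)]
    exact (η.2 i).2

/-- Addition of the amount `g` to site `0`, followed by a reflection. -/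
noncomputable def zigStep (hN : 0 < N) (v : Stable N) (g : ℝ) : Stable N :=
  reflect (step v ⟨0, hN⟩ g)

theorem measurable_zigStep (hN : 0 < N) :
    Measurable fun p : Stable N × ℝ => zigStep hN p.1 p.2 :=
  measurable_reflect.comp (measurable_step.comp
    (measurable_fst.prodMk (measurable_const.prodMk measurable_snd)))

theorem measurable_zigStep_right (hN : 0 < N) (v : Stable N) :
    Measurable fun g : ℝ => zigStep hN v g :=
  measurable_reflect.comp (measurable_step.comp
    (measurable_const.prodMk (measurable_const.prodMk measurable_id)))

theorem zigStep_mem (hN : 0 < N) {v : Stable N} (hv : v ∈ emptyFirst N) {g : ℝ} (h1 : 1 ≤ g)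
    (h2 : g < 2) : zigStep hN v g ∈ emptyFirst N ∧
      (zigStep hN v g).1 = zig (v.1 + g • unitVec 0) := by
  have h0 : v.1 ⟨0, hN⟩ = 0 := (hv ⟨0, hN⟩).1 rfl
  have hs : SweepReady ((⟨0, hN⟩ : Fin N) : ℕ) (v.1 + Pi.single ⟨0, hN⟩ g) :=
    sweepReady_add (Or.inl rfl) (by rwa [h0, zero_add]) (by rwa [h0, zero_add])
      fun i hi => (hv i).2 (by rw [Fin.lt_def] at hi; simp only at hi; omega)
  have hg : 0 ≤ g := by linarith
  refine ⟨reflect_mem_emptyFirst.2 (step_sweep_mem v ⟨0, hN⟩ hg rfl hs), ?_⟩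
  change (step v ⟨0, hN⟩ g).1 ∘ Fin.rev = _
  rw [step_sweep v ⟨0, hN⟩ hg rfl hs, afterSweep_comp_rev]
  congr 2
  ext i
  by_cases hi : i = ⟨0, hN⟩
  · subst hi
    simp [unitVec]
  · have hi' : (i : ℕ) ≠ 0 := fun h => hi (Fin.ext h)
    simp [unitVec, hi, hi']

/-- The configurations in `emptyFirst N` whose full sites have heights close to `M / 2`. -/
def near (N : ℕ) (M κ : ℝ) : Set (Stable N) :=
  {η | η ∈ emptyFirst N ∧ ∀ i : Fin N, 0 < (i : ℕ) → |η.1 i - M / 2| ≤ κ}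

theorem measurableSet_near (M κ : ℝ) : MeasurableSet (near N M κ) := by
  have : near N M κ = emptyFirst N ∩
      ⋂ i : Fin N, {η : Stable N | 0 < (i : ℕ) → |η.1 i - M / 2| ≤ κ} := by
    ext η
    simp [near]
  rw [this]
  refine measurableSet_emptyFirst.inter (MeasurableSet.iInter fun i => ?_)
  have hm : Measurable fun η : Stable N => |η.1 i - M / 2| := by
    have : Measurable fun η : Stable N => η.1 i :=
      (measurable_pi_apply i).comp measurable_subtype_coe
    exact measurable_norm.comp (this.sub_const _)
  by_cases hi : 0 < (i : ℕ)
  · simp only [hi, forall_const]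
    exact measurableSet_le hm measurable_const
  · simp [hi]

/-- The configuration that is reproduced by `zig` if the amount added is `M`. -/
noncomputable def fixedConfig (N : ℕ) (M : ℝ) (i : Fin N) : ℝ := if (i : ℕ) = 0 then 0 else M / 2

theorem zig_fixedConfig (M : ℝ) :
    zig (fixedConfig N M + M • unitVec 0) = fixedConfig N M := by
  have hacc : ∀ k, k < N → acc k (fixedConfig N M + M • unitVec 0) = M := by
    intro k
    induction k with
    | zero =>
      intro hk
      rw [acc_zero, coord_apply ⟨0, hk⟩]
      simp [fixedConfig, unitVec]
    | succ k ih =>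
      intro hk
      rw [acc_succ, ih (by omega), coord_apply ⟨k + 1, hk⟩]
      simp [fixedConfig, unitVec]
  ext i
  have := i.2
  rw [zig_apply]
  by_cases hi : 0 < (i : ℕ)
  · rw [if_pos hi, hacc _ (by omega), fixedConfig, if_neg hi.ne']
  · rw [if_neg hi, fixedConfig, if_pos (by omega)]

/-- Relative to the fixed configuration the step is `zig` of the deviation, whose entry at site 0 is
`g - M`; `abs_zig_le` allows it to be twice as large as the others. -/
theorem zigStep_near (hN : 0 < N) {M κ : ℝ} {v : Stable N} (hv : v ∈ near N M κ) {g : ℝ}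
    (h1 : 1 ≤ g) (h2 : g < 2) (hg : |g - M| ≤ 2 * κ) : zigStep hN v g ∈ near N M κ := by
  obtain ⟨h3, h4⟩ := zigStep_mem hN hv.1 h1 h2
  refine ⟨h3, fun i hi => ?_⟩
  have e : (zigStep hN v g).1 i - M / 2 =
      zig (v.1 + g • unitVec 0 - (fixedConfig N M + M • unitVec 0)) i := by
    rw [map_sub, ← h4, zig_fixedConfig, Pi.sub_apply, fixedConfig, if_neg hi.ne']
  rw [e]
  refine abs_zig_le ?_ (fun k hk => ?_) i
  · rw [coord_apply ⟨0, hN⟩]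
    have := (hv.1 ⟨0, hN⟩).1 rfl
    simpa [fixedConfig, unitVec, this] using hg
  · have hk' : (k : ℕ) ≠ 0 := hk.ne'
    simpa [fixedConfig, unitVec, hk'] using hv.2 k hk

theorem sub_removable_data (hN : 0 < N) {y v : Stable N} (hy : y ∈ emptyFirst N)
    (hv : v ∈ emptyFirst N) : coord 0 (y.1 - v.1) = 0 ∧ ∀ i, |(y.1 - v.1) i| ≤ 1 := by
  constructor
  · rw [map_sub, coord_apply ⟨0, hN⟩, coord_apply ⟨0, hN⟩, (hy ⟨0, hN⟩).1 rfl,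
      (hv ⟨0, hN⟩).1 rfl, sub_zero]
  · intro i
    have h1 := y.2 i
    have h2 := v.2 i
    rw [Pi.sub_apply, abs_le]
    constructor <;> linarith

theorem setLIntegral_Icc_add (F : ℝ → ℝ≥0∞) (A B s : ℝ) :
    ∫⁻ u in Set.Icc (A - s) (B - s), F (u + s) = ∫⁻ u in Set.Icc A B, F u := by
  rw [← lintegral_indicator measurableSet_Icc, ← lintegral_indicator measurableSet_Icc,
    ← lintegral_add_right_eq_self ((Set.Icc A B).indicator F) s]
  refine lintegral_congr fun u => ?_
  by_cases h : u + s ∈ Set.Icc A B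
  · have h' : u ∈ Set.Icc (A - s) (B - s) := ⟨by linarith [h.1], by linarith [h.2]⟩
    rw [Set.indicator_of_mem h, Set.indicator_of_mem h']
  · have h' : u ∉ Set.Icc (A - s) (B - s) := fun h' => h ⟨by linarith [h'.1], by linarith [h'.2]⟩
    rw [Set.indicator_of_notMem h, Set.indicator_of_notMem h']

/-- Parameters of a strategy: `m + 1` additions of about `c` make an empty site topple, and `j + 1`
additions of about `c` a site with height about `(m + 1) * c / 2`. -/
structure Params (a b c δ : ℝ) (m j : ℕ) : Prop where
  a_nonneg : 0 ≤ a
  b_le_one : b ≤ 1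
  δ_pos : 0 < δ
  lower : a ≤ c - (m + 1) * δ
  upper : c + (m + 1) * δ ≤ b
  fill_lt : m * (c + δ) < 1
  half_le : 1 / 2 ≤ m * (c - δ)
  top_le : 1 ≤ (m + 1) * c - (m + 1) * δ
  stay : (m + 1) * c / 2 + (m + 1) * δ + j * (c + δ) < 1
  exceed : 1 ≤ (m + 1) * c / 2 - (m + 1) * δ + (j + 1) * (c - δ)

theorem Params.δ_le {a b c δ : ℝ} {m j : ℕ} (hP : Params a b c δ m j) :
    δ ≤ (m + 1) * δ := by
  have := mul_nonneg (Nat.cast_nonneg m : (0 : ℝ) ≤ m) hP.δ_pos.le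
  linarith

theorem Params.sub_nonneg {a b c δ : ℝ} {m j : ℕ} (hP : Params a b c δ m j) : 0 ≤ c - δ := by
  linarith [hP.lower, hP.a_nonneg, hP.δ_le]

/-- The upper bound is contained in `stay`, which keeps half of the total below 1. -/
theorem Params.mem_Ico {a b c δ : ℝ} {m j : ℕ} (hP : Params a b c δ m j) {g : ℝ}
    (h1 : (m + 1) * c - (m + 1) * δ ≤ g) (h2 : g ≤ (m + 1) * c + (m + 1) * δ) :
    1 ≤ g ∧ g < 2 := by
  have := hP.stay
  have h3 : 0 ≤ (j : ℝ) * (c + δ) :=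
    mul_nonneg (Nat.cast_nonneg j) (by linarith [hP.sub_nonneg, hP.δ_pos])
  have h4 := hP.δ_pos.le.trans hP.δ_le
  exact ⟨hP.top_le.trans h1, by linarith⟩

/-- The configurations that `m` additions of about `c` at site `0` can produce. -/
def filled (hN : 0 < N) (c δ : ℝ) (m : ℕ) (y : Stable N) : Set (Stable N) :=
  {ξ | ∃ s ∈ Set.Icc (m * (c - δ)) (m * (c + δ)), ξ.1 = y.1 + Pi.single ⟨0, hN⟩ s}

theorem Params.mem_pre_filled {a b c δ : ℝ} {m j : ℕ} (hP : Params a b c δ m j) (hN : 0 < N)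
    {y : Stable N} (hy : y ∈ emptyFirst N) :
    y ∈ (pre a b (2 * δ))^[m] (filled hN c δ m y) := by
  have e : c - δ + 2 * δ = c + δ := by ring
  refine mem_pre_iterate_of_add hP.a_nonneg (l := c - δ) ?_ ?_ ?_ ⟨0, hN⟩ m ?_ fun s hs ξ hξ => ?_
  · linarith [hP.lower, hP.δ_le]
  · linarith [hP.δ_pos]
  · linarith [hP.upper, hP.δ_le]
  · rw [(hy ⟨0, hN⟩).1 rfl, e, zero_add]
    exact hP.fill_lt
  · rw [e] at hs
    exact ⟨s, hs, hξ⟩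

/-- A lower bound for the probability of one additional toppling at site `0`. -/
noncomputable def roundRate (N : ℕ) (a b δ : ℝ) (m : ℕ) : ℝ≥0∞ :=
  (rate N a b * ENNReal.ofReal (2 * δ)) ^ m * rate N a b

theorem ofReal_two_mul_ne_zero {δ : ℝ} (h : 0 < δ) : ENNReal.ofReal (2 * δ) ≠ 0 := by
  simpa using h

theorem roundRate_ne_zero {a b δ : ℝ} {m : ℕ} (h : 0 < δ) : roundRate N a b δ m ≠ 0 :=
  mul_ne_zero (pow_ne_zero _ (mul_ne_zero rate_ne_zero (ofReal_two_mul_ne_zero h))) rate_ne_zero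

/-- Given the sum `s` of the first `m` amounts, the last one has a density on [a, b]. The margins in
`lower` and `upper` ensure that, whatever `s` is, the total covers the interval of radius δ around
(m + 1) c. -/
theorem Params.round_le {a b c δ : ℝ} {m j : ℕ} (hP : Params a b c δ m j) (hN : 0 < N)
    {y : Stable N} (hy : y ∈ emptyFirst N) {f : Stable N → ℝ≥0∞} (hf : Measurable f) :
    roundRate N a b δ m *
      ∫⁻ g in Set.Icc ((m + 1) * c - δ) ((m + 1) * c + δ), f (step y ⟨0, hN⟩ g) ≤
    (avg (kernel N a b))^[m + 1] f y := by
  rw [roundRate, mul_assoc, Function.iterate_succ_apply]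
  refine pow_mul_le_avg_iterate (measurable_avg hf) ?_ m (hP.mem_pre_filled hN hy)
  rintro ξ ⟨s, hs, hξ⟩
  have hsub : Set.Icc ((m + 1) * c - δ - s) ((m + 1) * c + δ - s) ⊆ Set.Icc a b := by
    refine Set.Icc_subset_Icc ?_ ?_
    · linarith [hP.lower, hs.2]
    · linarith [hP.upper, hs.1]
  refine le_trans ?_ (rate_mul_le_avg hf ξ ⟨0, hN⟩ hsub)
  refine mul_le_mul_right ?_ _
  rw [← setLIntegral_Icc_add _ _ _ s]
  refine (setLIntegral_congr_fun measurableSet_Icc fun u hu => ?_).le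
  have hs0 : 0 ≤ s := (mul_nonneg (Nat.cast_nonneg m) hP.sub_nonneg).trans hs.1
  rw [step_add y ξ ⟨0, hN⟩ hs0 (hP.a_nonneg.trans (hsub hu).1) hξ, add_comm]

/-- The kernel of `zigStep` with an amount drawn from an interval of length `δ`. -/
noncomputable def zigKernel (hN : 0 < N) (M δ : ℝ) : Kernel (Stable N) (Stable N) where
  toFun v := (volume.restrict (Set.Icc (M - δ / 2) (M + δ / 2))).map fun g => zigStep hN v g
  measurable' := by
    refine Measure.measurable_of_measurable_coe _ fun s hs => ?_
    have h : ∀ v : Stable N, ((volume.restrict (Set.Icc (M - δ / 2) (M + δ / 2))).map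
        fun g => zigStep hN v g) s = volume.restrict (Set.Icc (M - δ / 2) (M + δ / 2))
          (Prod.mk v ⁻¹' ((fun p : Stable N × ℝ => zigStep hN p.1 p.2) ⁻¹' s)) := by
      intro v
      rw [Measure.map_apply (measurable_zigStep_right hN v) hs]
      rfl
    simp_rw [h]
    exact measurable_measure_prodMk_left (measurable_zigStep hN hs)

theorem avg_zigKernel (hN : 0 < N) (M δ : ℝ) {f : Stable N → ℝ≥0∞} (hf : Measurable f)
    (v : Stable N) : avg (zigKernel hN M δ) f v =
      ∫⁻ g in Set.Icc (M - δ / 2) (M + δ / 2), f (zigStep hN v g) := by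
  change ∫⁻ ξ, f ξ ∂((volume.restrict (Set.Icc (M - δ / 2) (M + δ / 2))).map
    fun g => zigStep hN v g) = _
  rw [lintegral_map hf (measurable_zigStep_right hN v)]

theorem measurable_reflect_iterate (L : ℕ) : Measurable (reflect^[L] : Stable N → Stable N) :=
  measurable_reflect.iterate L

/-- Coupling by translation: the copy from `y` uses total `g + γ` where the copy from `v` uses `g`.
By linearity the next difference does not depend on `g`, so one deterministic choice of `γ` per
round makes the copies meet after `L` rounds. -/
theorem Params.rounds_le {a b c δ : ℝ} {m j : ℕ} (hP : Params a b c δ m j) (hN : 0 < N) (L : ℕ)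
    {y v : Stable N} (hy : y ∈ emptyFirst N) (hv : v ∈ emptyFirst N)
    (hd : Removable (δ / 2) L (y.1 - v.1)) {f : Stable N → ℝ≥0∞} (hf : Measurable f) :
    roundRate N a b δ m ^ L * (avg (zigKernel hN ((m + 1) * c) δ))^[L] f v ≤
      (avg (kernel N a b))^[(m + 1) * L] (f ∘ reflect^[L]) y := by
  induction L generalizing y v with
  | zero =>
    have : y = v := Subtype.ext (sub_eq_zero.1 hd)
    simp [this]
  | succ L ih =>
    obtain ⟨γ, hγ, hd⟩ := hd
    have hγ' := abs_le.1 hγ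
    have hδ := hP.δ_pos
    have hδm := hP.δ_le
    set M : ℝ := (m + 1) * c with hM
    have hfr : ∀ k, Measurable (f ∘ reflect^[k]) := fun k =>
      hf.comp (measurable_reflect_iterate k)
    have hrefl : ∀ ξ : Stable N, (avg (kernel N a b))^[(m + 1) * L] (f ∘ reflect^[L + 1]) ξ =
        (avg (kernel N a b))^[(m + 1) * L] (f ∘ reflect^[L]) (reflect ξ) := by
      intro ξ
      have := congrFun (avg_iterate_comp_reflect hP.a_nonneg hP.b_le_one (hfr L) ((m + 1) * L)) ξ
      exact this
    rw [mul_add, mul_one, add_comm ((m + 1) * L),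
      Function.iterate_add_apply (avg (kernel N a b)) (m + 1) ((m + 1) * L)]
    refine le_trans ?_ (hP.round_le hN hy (measurable_avg_iterate (hfr (L + 1)) _))
    rw [pow_succ', mul_assoc]
    gcongr
    rw [Function.iterate_succ_apply', avg_zigKernel hN M δ (measurable_avg_iterate hf L)]
    simp only [hrefl]
    change _ * ∫⁻ g in _, (avg (zigKernel hN M δ))^[L] f (zigStep hN v g) ≤
      ∫⁻ g in _, (avg (kernel N a b))^[(m + 1) * L] (f ∘ reflect^[L]) (zigStep hN y g)
    -- `zigKernel` uses only the middle half of the available interval, which leaves room for a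
    -- shift by at most δ/2.
    have hsub : Set.Icc (M - δ / 2 + γ) (M + δ / 2 + γ) ⊆ Set.Icc (M - δ) (M + δ) :=
      Set.Icc_subset_Icc (by linarith) (by linarith)
    refine le_trans ?_ (lintegral_mono_set hsub)
    rw [← setLIntegral_Icc_add _ (M - δ / 2 + γ) (M + δ / 2 + γ) γ, add_sub_cancel_right, add_sub_cancel_right,
      ← lintegral_const_mul]
    · refine setLIntegral_mono' measurableSet_Icc fun g hg => ?_
      obtain ⟨v1, v2⟩ := hP.mem_Ico (g := g) (by linarith [hg.1]) (by linarith [hg.2])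
      obtain ⟨y1, y2⟩ := hP.mem_Ico (g := g + γ) (by linarith [hg.1]) (by linarith [hg.2])
      obtain ⟨hv1, hv2⟩ := zigStep_mem hN hv v1 v2
      obtain ⟨hy1, hy2⟩ := zigStep_mem hN hy y1 y2
      refine ih hy1 hv1 ?_
      rw [hy2, hv2, ← map_sub]
      convert hd using 2
      rw [add_smul]
      abel
    · exact (measurable_avg_iterate hf L).comp (measurable_zigStep_right hN v)

theorem Params.pow_le_near {a b c δ : ℝ} {m j : ℕ} (hP : Params a b c δ m j) (hN : 0 < N) (L : ℕ)
    {v : Stable N} (hv : v ∈ near N ((m + 1) * c) ((m + 1) * δ)) :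
    ENNReal.ofReal δ ^ L ≤ (avg (zigKernel hN ((m + 1) * c) δ))^[L]
      ((near N ((m + 1) * c) ((m + 1) * δ)).indicator 1) v := by
  induction L generalizing v with
  | zero => simp [hv]
  | succ L ih =>
    have hδ := hP.δ_pos
    have hδm := hP.δ_le
    have hm : Measurable ((near N ((m + 1) * c) ((m + 1) * δ)).indicator (1 : Stable N → ℝ≥0∞)) :=
      measurable_one.indicator (measurableSet_near _ _)
    rw [Function.iterate_succ_apply', avg_zigKernel hN _ _ (measurable_avg_iterate hm L), pow_succ]
    calc ENNReal.ofReal δ ^ L * ENNReal.ofReal δ =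
        ∫⁻ _ in Set.Icc ((m + 1) * c - δ / 2) ((m + 1) * c + δ / 2), ENNReal.ofReal δ ^ L := by
          rw [setLIntegral_const, Real.volume_Icc]
          congr 2
          ring
      _ ≤ _ := setLIntegral_mono' measurableSet_Icc fun g hg => by
          obtain ⟨v1, v2⟩ := hP.mem_Ico (g := g) (by linarith [hg.1]) (by linarith [hg.2])
          refine ih (zigStep_near hN hv v1 v2 ?_)
          rw [abs_le]
          constructor <;> linarith [hg.1, hg.2]

/-! ### Returns at two successive times -/

/-- By `stay`, `j` additions at `p` cause no toppling; by `exceed`, the next one does and starts a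
sweep. -/
theorem Params.mem_pre_emptyLast {a b c δ : ℝ} {m j : ℕ} (hP : Params a b c δ m j) {p : Fin N}
    {η : Stable N} (hleft : (p : ℕ) = 0 ∨ ((p : ℕ) = 1 ∧ coord 0 η.1 = 0))
    (hp : |η.1 p - (m + 1) * c / 2| ≤ (m + 1) * δ) (hfull : ∀ i : Fin N, p < i → 1 / 2 ≤ η.1 i) :
    η ∈ (pre a b (2 * δ))^[j + 1] (emptyLast N) := by
  have e : c - δ + 2 * δ = c + δ := by ring
  have hδ := hP.δ_pos
  have hδm := hP.δ_le
  have hp' := abs_le.1 hp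
  rw [Function.iterate_succ_apply]
  refine mem_pre_iterate_of_add hP.a_nonneg (l := c - δ) ?_ ?_ ?_ p j ?_ fun s hs ξ hξ =>
    ⟨p, c - δ, ?_, ?_, fun u hu => ?_⟩
  · linarith [hP.lower]
  · linarith
  · linarith [hP.upper]
  · rw [e]
    linarith [hP.stay]
  · linarith [hP.lower]
  · linarith [hP.upper]
  · rw [e] at hu hs
    have hξp : ξ.1 p = η.1 p + s := by rw [hξ]; simp
    have hξi : ∀ i, i ≠ p → ξ.1 i = η.1 i := by
      intro i hi
      rw [hξ]
      simp [hi]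
    refine step_sweep_mem ξ p (by linarith [hu.1, hP.sub_nonneg]) rfl
      (sweepReady_add ?_ ?_ ?_ fun i hi => ?_)
    · refine hleft.imp_right fun h => ⟨h.1, ?_⟩
      have h0 : 0 < N := by have := p.2; omega
      have := h.2
      rw [coord_apply ⟨0, h0⟩] at this ⊢
      rw [hξi _ (by rintro rfl; simp at h), this]
    · rw [hξp]
      linarith [hP.exceed, hu.1, hs.1]
    · linarith [(ξ.2 p).2, hu.2, hP.upper, hP.b_le_one]
    · rw [hξi i (by rintro rfl; exact lt_irrefl _ hi)]
      exact hfull i hi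

theorem Params.le_avg_of_reflect {a b c δ : ℝ} {m j : ℕ} (hP : Params a b c δ m j) {ξ : Stable N}
    (h : reflect ξ ∈ (pre a b (2 * δ))^[j + 1] (emptyLast N)) :
    (rate N a b * ENNReal.ofReal (2 * δ)) ^ (j + 1) ≤
      (avg (kernel N a b))^[j + 1] ((emptyFirst N).indicator 1) ξ := by
  have hm : Measurable ((emptyLast N).indicator (1 : Stable N → ℝ≥0∞)) :=
    measurable_one.indicator measurableSet_emptyLast
  rw [indicator_emptyFirst, avg_iterate_comp_reflect hP.a_nonneg hP.b_le_one hm]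
  have := pow_mul_le_avg_iterate hm (p := 1) (fun ξ hξ => by simp [hξ]) (j + 1) h
  rwa [mul_one] at this

/-- Fill site 0 with `m` additions, which bring it to at least 1/2, then topple the last site with
`j + 1` additions: the sweep runs leftwards through the full line and empties site 0. -/
theorem Params.return_filled {a b c δ : ℝ} {m j : ℕ} (hP : Params a b c δ m j) (hN : 2 ≤ N)
    {x : Stable N} (hx : x ∈ near N ((m + 1) * c) ((m + 1) * δ)) :
    (rate N a b * ENNReal.ofReal (2 * δ)) ^ (m + j + 1) ≤
      (avg (kernel N a b))^[m + j + 1] ((emptyFirst N).indicator 1) x := by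
  have hm : Measurable ((emptyFirst N).indicator (1 : Stable N → ℝ≥0∞)) :=
    measurable_one.indicator measurableSet_emptyFirst
  rw [add_assoc, pow_add, Function.iterate_add_apply]
  refine pow_mul_le_avg_iterate (measurable_avg_iterate hm _) ?_ m
    (hP.mem_pre_filled (by omega) hx.1)
  rintro ξ ⟨s, hs, hξ⟩
  have hξ0 : ∀ i : Fin N, 0 < (i : ℕ) → ξ.1 i = x.1 i := by
    intro i hi
    have : i ≠ ⟨0, by omega⟩ := fun h => by simp [h] at hi
    rw [hξ]
    simp [this]
  refine hP.le_avg_of_reflect (hP.mem_pre_emptyLast (p := ⟨0, by omega⟩) (Or.inl rfl) ?_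
    fun i hi => ?_)
  · change |ξ.1 (Fin.rev ⟨0, _⟩) - _| ≤ _
    have h0 : 0 < ((Fin.rev ⟨0, by omega⟩ : Fin N) : ℕ) := by
      rw [Fin.val_rev]
      simp only
      omega
    rw [hξ0 _ h0]
    exact hx.2 _ h0
  · change _ ≤ ξ.1 i.rev
    rcases Nat.eq_zero_or_pos (i.rev : ℕ) with h0 | h0
    · have : i.rev = ⟨0, by omega⟩ := Fin.ext h0
      rw [this, hξ]
      have := (hx.1 ⟨0, by omega⟩).1 rfl
      simp only [Pi.add_apply, this, Pi.single_eq_same]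
      linarith [hs.1, hP.half_le]
    · rw [hξ0 _ h0]
      exact (hx.1 _).2 h0.ne'

/-- One more addition topples site 0 and leaves the last site empty, the others still near (m + 1) c
/ 2. Now `j + 1` additions at the last but one site start the sweep back to site 0. This is the `p =
1` case of `SweepReady`, mirrored; it needs two sites. -/
theorem Params.return_toppled {a b c δ : ℝ} {m j : ℕ} (hP : Params a b c δ m j) (hN : 2 ≤ N)
    {x : Stable N} (hx : x ∈ near N ((m + 1) * c) ((m + 1) * δ)) :
    (rate N a b * ENNReal.ofReal (2 * δ)) ^ (m + j + 1 + 1) ≤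
      (avg (kernel N a b))^[m + j + 1 + 1] ((emptyFirst N).indicator 1) x := by
  have hm : Measurable ((emptyFirst N).indicator (1 : Stable N → ℝ≥0∞)) :=
    measurable_one.indicator measurableSet_emptyFirst
  have hδ := hP.δ_pos
  have hδm := hP.δ_le
  have e : c - δ + 2 * δ = c + δ := by ring
  have h0 : 0 < N := by omega
  have hmem : x ∈ (pre a b (2 * δ))^[m + 1]
      {ξ | reflect ξ ∈ near N ((m + 1) * c) ((m + 1) * δ)} := by
    rw [Function.iterate_succ_apply]
    refine (pre_mono.iterate m ?_) (hP.mem_pre_filled h0 hx.1)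
    rintro ξ ⟨s, hs, hξ⟩
    refine ⟨⟨0, h0⟩, c - δ, by linarith [hP.lower], by linarith [hP.upper], fun u hu => ?_⟩
    rw [e] at hu
    have hs0 : 0 ≤ s := (mul_nonneg (Nat.cast_nonneg m) hP.sub_nonneg).trans hs.1
    rw [Set.mem_ofPred_eq, step_add x ξ ⟨0, h0⟩ hs0 (hP.sub_nonneg.trans hu.1) hξ]
    have g1 : (m + 1) * c - (m + 1) * δ ≤ s + u := by linarith [hs.1, hu.1]
    have g2 : s + u ≤ (m + 1) * c + (m + 1) * δ := by linarith [hs.2, hu.2]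
    obtain ⟨g3, g4⟩ := hP.mem_Ico g1 g2
    refine zigStep_near h0 hx g3 g4 ?_
    rw [abs_le]
    constructor <;> linarith
  rw [show m + j + 1 + 1 = (m + 1) + (j + 1) by ring, pow_add, Function.iterate_add_apply]
  refine pow_mul_le_avg_iterate (measurable_avg_iterate hm _) (fun ξ hξ => ?_) (m + 1) hmem
  refine hP.le_avg_of_reflect (hP.mem_pre_emptyLast (p := ⟨1, by omega⟩)
    (Or.inr ⟨rfl, ?_⟩) (hξ.2 _ Nat.one_pos) fun i hi => (hξ.1 i).2 ?_)
  · rw [coord_apply ⟨0, h0⟩]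
    exact (hξ.1 ⟨0, h0⟩).1 rfl
  · rw [Fin.lt_def] at hi
    simp only at hi
    omega

end Rounds

/-! ### Choice of the parameters -/

theorem exists_irrational_amount {a b : ℝ} (ha : 0 ≤ a) (hab : a < b) :
    ∃ c, Irrational c ∧ a < c ∧ c < b ∧ 0 < c ∧ (c < 1 / 2 ∨ 1 / 2 < c) := by
  by_cases hb : 1 / 2 < b
  · obtain ⟨c, hc, h1, h2⟩ := exists_irrational_btwn (max_lt hab hb)
    rw [max_lt_iff] at h1
    exact ⟨c, hc, h1.1, h2, by linarith, Or.inr h1.2⟩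
  · obtain ⟨c, hc, h1, h2⟩ := exists_irrational_btwn hab
    exact ⟨c, hc, h1, h2, by linarith, Or.inl (by linarith)⟩

theorem exists_least_gt {c : ℝ} (hc : 0 < c) (x : ℝ) (hx : 0 < x) :
    ∃ n : ℕ, n * c ≤ x ∧ x < (n + 1) * c := by
  refine ⟨⌊x / c⌋₊, ?_, ?_⟩
  · rw [← le_div_iff₀ hc]
    exact Nat.floor_le (by positivity)
  · rw [← div_lt_iff₀ hc]
    exact Nat.lt_floor_add_one _

theorem natCast_mul_ne {c : ℝ} (hc : Irrational c) (k : ℕ) {n : ℕ} (hn : n ≠ 0) :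
    (k : ℝ) * c ≠ n := by
  intro h
  have hk : k ≠ 0 := by
    rintro rfl
    rw [Nat.cast_zero, zero_mul] at h
    exact hn (by exact_mod_cast h.symm)
  exact (hc.natCast_mul hk).ne_nat n h

theorem eventually_pos {f : ℝ → ℝ} (hf : Continuous f) (h0 : 0 < f 0) :
    ∀ᶠ δ in nhdsWithin (0 : ℝ) (Set.Ioi 0), 0 < f δ :=
  ((hf.tendsto 0).mono_left nhdsWithin_le_nhds).eventually (lt_mem_nhds h0)

/-- With `m` and `j` the largest numbers of additions of `c` that keep, respectively, an empty site
and a site of height (m + 1) c / 2 from toppling, all inequalities hold strictly at δ = 0, hence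
also for small δ > 0. -/
theorem exists_params {a b : ℝ} (ha : 0 ≤ a) (hab : a < b) (hb : b ≤ 1) :
    ∃ (c δ : ℝ) (m j : ℕ), Params a b c δ m j ∧ 0 < c - δ ∧ (c < 1 / 2 ∨ 1 / 2 ≤ c - δ) := by
  obtain ⟨c, hirr, hac, hcb, hc0, hhalf⟩ := exists_irrational_amount ha hab
  obtain ⟨m, hm1, hm2⟩ := exists_least_gt hc0 1 one_pos
  have hm1' : (m : ℝ) * c < 1 := by
    refine lt_of_le_of_ne hm1 ?_
    exact_mod_cast natCast_mul_ne hirr m one_ne_zero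
  have hmhalf : 1 / 2 < (m : ℝ) * c := by
    rcases hhalf with h | h
    · linarith
    · have hm0 : m ≠ 0 := by
        rintro rfl
        simp only [Nat.cast_zero, zero_add, one_mul] at hm2
        linarith
      have : (1 : ℝ) ≤ m := by exact_mod_cast Nat.one_le_iff_ne_zero.2 hm0
      nlinarith
  obtain ⟨j, hj1, hj2⟩ := exists_least_gt hc0 (1 - (m + 1) * c / 2) (by linarith)
  have hj1' : (j : ℝ) * c < 1 - (m + 1) * c / 2 := by
    -- Equality would mean (m + 1 + 2j) c = 2, contradicting irrationality.
    refine lt_of_le_of_ne hj1 fun h => natCast_mul_ne hirr (m + 1 + 2 * j) two_ne_zero ?_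
    push_cast
    linarith
  have ev : ∀ᶠ δ in nhdsWithin (0 : ℝ) (Set.Ioi 0), Params a b c δ m j ∧ 0 < c - δ ∧
      (c < 1 / 2 ∨ 1 / 2 ≤ c - δ) := by
    filter_upwards [self_mem_nhdsWithin,
      eventually_pos (f := fun δ => c - (m + 1) * δ - a) (by fun_prop) (by simpa using hac),
      eventually_pos (f := fun δ => b - (c + (m + 1) * δ)) (by fun_prop) (by simpa using hcb),
      eventually_pos (f := fun δ => 1 - m * (c + δ)) (by fun_prop) (by simpa using hm1'),
      eventually_pos (f := fun δ => m * (c - δ) - 1 / 2) (by fun_prop)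
        (by rw [sub_zero]; linarith),
      eventually_pos (f := fun δ => (m + 1) * c - (m + 1) * δ - 1) (by fun_prop)
        (by rw [mul_zero, sub_zero]; linarith),
      eventually_pos (f := fun δ => 1 - ((m + 1) * c / 2 + (m + 1) * δ + j * (c + δ)))
        (by fun_prop) (by rw [mul_zero, add_zero, add_zero]; linarith),
      eventually_pos (f := fun δ => (m + 1) * c / 2 - (m + 1) * δ + (j + 1) * (c - δ) - 1)
        (by fun_prop) (by rw [mul_zero, sub_zero, sub_zero]; linarith),
      eventually_pos (f := fun δ => c - δ) (by fun_prop) (by simpa using hc0),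
      eventually_pos (f := fun δ => |c - 1 / 2| - δ) (by fun_prop) (by
        rw [sub_zero, abs_pos]
        rcases hhalf with h | h <;> intro h' <;> linarith)]
      with δ h0 h1 h2 h3 h4 h5 h6 h7 h8 h9
    refine ⟨⟨ha, hb, h0, by linarith, by linarith, by linarith, by linarith, by linarith,
      by linarith, by linarith⟩, h8, hhalf.imp_right fun h => ?_⟩
    rw [abs_of_pos (by linarith)] at h9
    linarith
  obtain ⟨δ, hδ⟩ := ev.exists
  exact ⟨c, δ, m, j, hδ⟩

/-! ### The minorization for the sandpile kernel -/

theorem Params.exists_mem_near {N : ℕ} {a b c δ : ℝ} {m j : ℕ} (hP : Params a b c δ m j) :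
    ∃ v : Stable N, v ∈ near N ((m + 1) * c) ((m + 1) * δ) := by
  have hδ := hP.δ_pos.le.trans hP.δ_le
  have h1 := hP.top_le
  obtain ⟨-, h2⟩ := hP.mem_Ico (g := (m + 1) * c) (by linarith) (by linarith)
  refine ⟨⟨fixedConfig N ((m + 1) * c), fun i => ?_⟩, fun i => ⟨fun hi => ?_, fun hi => ?_⟩,
    fun i hi => ?_⟩
  · unfold fixedConfig
    split_ifs
    · norm_num
    · constructor <;> linarith
  · simp [fixedConfig, hi]
  · simp only [fixedConfig, hi, if_false]
    linarith
  · simpa [fixedConfig, hi.ne'] using hδ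

theorem exists_minorizes {N : ℕ} (hN : 2 ≤ N) {a b : ℝ} (ha : 0 ≤ a) (hab : a < b)
    (hb : b ≤ 1) : ∃ n, ∃ m : Measure (Stable N), m Set.univ ≠ 0 ∧
      Minorizes (kernel N a b) n m := by
  have hN0 : 0 < N := by omega
  obtain ⟨c, δ, m, j, hP, hcδ, hhalf⟩ := exists_params ha hab hb
  have hδ := hP.δ_pos
  have hδm := hP.δ_le
  obtain ⟨T, q, hq, hhit⟩ := exists_le_sum_emptyFirst hN0 ha hb hδ (by linarith [hP.lower])
    (by linarith [hP.upper]) hcδ hhalf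
  obtain ⟨L, hL⟩ := exists_removable (N := N) (half_pos hδ)
  obtain ⟨v, hv⟩ := hP.exists_mem_near (N := N)
  set K := zigKernel hN0 ((m + 1) * c) δ
  set C := near N ((m + 1) * c) ((m + 1) * δ)
  set r := rate N a b * ENNReal.ofReal (2 * δ)
  have hr : r ≠ 0 := mul_ne_zero rate_ne_zero (ofReal_two_mul_ne_zero hδ)
  have hC : MeasurableSet C := measurableSet_near _ _
  -- The reference copy starts near the fixed configuration and stays there, so the minorizing
  -- measure charges `C`, from which the returns at two successive times are possible.
  have hρ : (K ^ (2 * L)) v C ≠ 0 := by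
    have h1 := hP.pow_le_near hN0 (2 * L) hv
    rw [← lintegral_kernel_pow (measurable_one.indicator hC), lintegral_indicator_one hC] at h1
    exact ((ENNReal.pow_pos (ENNReal.ofReal_pos.2 hδ) _).trans_le h1).ne'
  have heven : (reflect^[2 * L] : Stable N → Stable N) = id :=
    Function.Involutive.iterate_two_mul reflect_reflect L
  obtain ⟨n, ε, hε, hmin⟩ := exists_minorizes_of_hitting (P := kernel N a b) hC
    measurableSet_emptyFirst (fun _ h => h.1) hρ
    (q := min (min q (roundRate N a b δ m ^ (2 * L))) (min (r ^ (m + j + 1)) (r ^ (m + j + 1 + 1))))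
    (by
      rw [← pos_iff_ne_zero] at *
      exact lt_min (lt_min hq (ENNReal.pow_pos (pos_iff_ne_zero.2 (roundRate_ne_zero hδ)) _))
        (lt_min (ENNReal.pow_pos hr _) (ENNReal.pow_pos hr _)))
    (l := (m + 1) * (2 * L)) (r := m + j + 1)
    (fun x => ((min_le_left _ _).trans (min_le_left _ _)).trans (hhit x))
    (fun x hx f hf => by
      obtain ⟨h1, h2⟩ := sub_removable_data hN0 hx hv.1
      have := hP.rounds_le hN0 (2 * L) hx hv.1 (hL _ h1 h2) hf
      rw [heven, Function.comp_id, ← lintegral_kernel_pow hf] at this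
      refine le_trans ?_ this
      exact mul_le_mul_left ((min_le_left _ _).trans (min_le_right _ _)) _)
    (fun x hx => ((min_le_right _ _).trans (min_le_left _ _)).trans (hP.return_filled hN hx))
    (fun x hx => ((min_le_right _ _).trans (min_le_right _ _)).trans (hP.return_toppled hN hx))
  refine ⟨n, ε • (K ^ (2 * L)) v, ?_, hmin⟩
  rw [Measure.smul_apply, smul_eq_mul]
  exact mul_ne_zero hε fun h => hρ (measure_mono_null (Set.subset_univ _) h)

theorem lawAt_eq_iterate (N : ℕ) (a b : ℝ) (ν : Measure (Stable N)) (t : ℕ) :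
    lawAt N a b ν t = (fun μ : Measure (Stable N) => μ.bind (kernel N a b))^[t] ν := by
  induction t with
  | zero => rfl
  | succ t ih =>
    rw [Function.iterate_succ_apply', ← ih]
    rfl

end Zhang

theorem theorem3p1 (N : ℕ) (hN : 2 ≤ N) (a b : ℝ) (ha : 0 ≤ a) (hab : a < b) (hb : b ≤ 1) :
    ∃ μ : MeasureTheory.Measure (Zhang.Stable N),
      MeasureTheory.IsProbabilityMeasure μ ∧
      (Zhang.kernel N a b).Invariant μ ∧
      (∀ μ' : MeasureTheory.Measure (Zhang.Stable N), MeasureTheory.IsProbabilityMeasure μ' →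
        (Zhang.kernel N a b).Invariant μ' → μ' = μ) ∧
      (∀ ν : MeasureTheory.Measure (Zhang.Stable N), MeasureTheory.IsProbabilityMeasure ν →
        Filter.Tendsto (fun t : ℕ => Zhang.tvDist (Zhang.lawAt N a b ν t) μ)
          Filter.atTop (nhds 0)) := by
  have := Zhang.isMarkovKernel_kernel (a := a) (b := b) (show 0 < N by omega) hab
  have : Nonempty (Zhang.Stable N) := ⟨⟨0, fun x => by simp⟩⟩
  obtain ⟨n, m, h0, hm⟩ := Zhang.exists_minorizes hN ha hab hb
  simp only [Zhang.lawAt_eq_iterate]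
  exact hm.ergodic h0
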